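/- Let $0\le 2k\le n$, and let $V=\mathbb{C}^n$ have basis $p_1,\dots,p_{n-k},q_1,\dots,q_k$, with the nilpotent endomorphism $N$ given by $N(p_i)=p_{i-1}$, $N(q_i)=q_{i-1}$, $p_0=q_0=0$. Let $Y$ be the Springer fiber of $N$: the variety of complete flags $0=F_0\subset F_1\subset\dots\subset F_n=V$, $\dim F_i=i$, with $N F_i\subseteq F_{i-1}$ for $1\le i\le n$. A row strict tableau $w$ of shape $(n-k,k)$ is a filling of two left-justified rows, of lengths $n-k$ (top) and $k$ (bottom), by the numbers $1,\dots,n$, each used once, strictly decreasing from left to right in each row; it is standard if its columns are strictly decreasing from top to bottom as well. Let $w_\wedge$ and $w_\vee$ be the sets of numbers in the top and the bottom row, and mark the point $i\in\{1,\dots,n\}$ on a line by $\wedge$ or $\vee$ accordingly. Let $\mathcal{F}(w)$ be the flag in $Y$ whose $i$-th subspace is $\langle p_1,\dots,p_{t_i},q_1,\dots,q_{b_i}\rangle$, where $t_i=\#\{j\in w_\wedge: j\le i\}$ and $b_i=\#\{j\in w_\vee: j\le i\}$. Let $t\in\mathbb{C}^*$ act on flags through $p_i\mapsto t^{-1}p_i$,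 $q_i\mapsto tq_i$, let $Y_w^0=\{y\in Y:\lim_{t\to\infty}t\cdot y=\mathcal{F}(w)\}$, and let $Y_w=\overline{Y_w^0}$. For a standard tableau $S$ in which $i$ lies in column $c(i)$ (columns are counted from $1$, from the left), let $Y_{(S)}$ be the irreducible component of $Y$ attached to $S$, that is, the closure of the set of the flags in $Y$ with $F_i\subseteq F_{i-1}+\operatorname{im}N^{c(i)-1}$ for all $i\in\{1,\dots,n\}$. A cup diagram on the points $1,\dots,n$ joins some disjoint pairs of points by cups, drawn below the line, and attaches to every other point a ray going down to infinity, so that no two cups or rays cross. It is oriented by $w$ if every cup has one end marked $\wedge$ and the other marked $\vee$; a cup is counter-clockwise if its left end is marked $\vee$ and its right end $\wedge$. Among the cup diagrams that are oriented by $w$ with only counter-clockwise cups there is exactly one, $m(w)$, with the maximal number of cups; there is exactly one cup diagram $C(w)$ with $k$ cups that is oriented by $w$ and contains all cups of $m(w)$; and there is exactly one standard tableau $S(w)$ of shape $(n-k,k)$ whose bottom row consists of the left ends of the cups of $C(w)$. **Theorem.** For every row strict tableau $w$ of shape $(n-k,k)$ the standard tableau $S(w)$ is well defined, and $Y_w$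 is the set of exactly those flags $F_\bullet\in Y_{(S(w))}$ for which $F_i$ coincides with the $i$-th subspace of $\mathcal{F}(w)$ for every $i\in w_\wedge\cap S(w)_\vee$. In particular, $Y_S=Y_{(S)}$ for every standard tableau $S$ of shape $(n-k,k)$. -/

import Mathlib

open Filter Topology

noncomputable section

namespace TwoRowSpringer

/-! ### Complete flags -/

/-- A complete flag `F 0 ⊂ F 1 ⊂ ⋯ ⊂ F n` of subspaces of `V`, with `dim (F i) = i`. -/
@[ext]
structure CompleteFlag (n : ℕ) (V : Type*) [AddCommGroup V] [Module ℂ V] where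
  space : Fin (n + 1) → Submodule ℂ V
  mono : Monotone space
  finrank_eq : ∀ i, Module.finrank ℂ (space i) = (i : ℕ)

/-- The image of a complete flag under a linear automorphism. -/
def CompleteFlag.map {n : ℕ} {V : Type*} [AddCommGroup V] [Module ℂ V]
    (e : V ≃ₗ[ℂ] V) (F : CompleteFlag n V) : CompleteFlag n V where
  space i := (F.space i).map (e : V →ₗ[ℂ] V)
  mono _ _ h := Submodule.map_mono (F.mono h)
  finrank_eq i := by rw [LinearEquiv.finrank_map_eq, F.finrank_eq]

/-- The usual (compact Hausdorff) topology of the complex flag variety: a flag is identified with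
the tuple of orthogonal projections onto its members. -/
instance {n : ℕ} {V : Type*} [NormedAddCommGroup V] [InnerProductSpace ℂ V]
    [FiniteDimensional ℂ V] : TopologicalSpace (CompleteFlag n V) :=
  TopologicalSpace.induced
    (fun (F : CompleteFlag n V) (i : Fin (n + 1)) => ((F.space i).starProjection : V →L[ℂ] V))
    inferInstance

/-! ### The vector space, the nilpotent endomorphism, the Springer fiber -/

/-- `V = ℂⁿ` with its ordered basis `p_1, …, p_{n-k}, q_1, …, q_k`. Indices are shifted by one:
the basis vector at `Sum.inl j` is `p_{j+1}`, the one at `Sum.inr j` is `q_{j+1}`. -/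
abbrev V (n k : ℕ) : Type := EuclideanSpace ℂ (Fin (n - k) ⊕ Fin k)

/-- The basis `p_1, …, p_{n-k}, q_1, …, q_k`. -/
def pq (n k : ℕ) : Module.Basis (Fin (n - k) ⊕ Fin k) ℂ (V n k) :=
  (EuclideanSpace.basisFun (Fin (n - k) ⊕ Fin k) ℂ).toBasis

/-- The nilpotent endomorphism `p_i ↦ p_{i-1}`, `q_i ↦ q_{i-1}`, where `p_0 = q_0 = 0`. -/
def N (n k : ℕ) : V n k →ₗ[ℂ] V n k :=
  (pq n k).constr ℂ (Sum.elim
    (fun j => if (j : ℕ) = 0 then 0 else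
      pq n k (Sum.inl ⟨(j : ℕ) - 1, lt_of_le_of_lt (Nat.sub_le _ _) j.isLt⟩))
    (fun j => if (j : ℕ) = 0 then 0 else
      pq n k (Sum.inr ⟨(j : ℕ) - 1, lt_of_le_of_lt (Nat.sub_le _ _) j.isLt⟩)))

/-- The Springer fiber `Y`: complete flags with `N F_i ⊆ F_{i-1}` for `1 ≤ i ≤ n`. -/
def springerFiber (n k : ℕ) : Set (CompleteFlag n (V n k)) :=
  {F | ∀ i : Fin n, (F.space i.succ).map (N n k) ≤ F.space i.castSucc}

/-! ### Tableaux

The number `i ∈ {1, …, n}` is represented by the element `i - 1` of `Fin n`; thus for `i : Fin n`,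
`F.space i.succ` is the member of the flag labelled by that number and `F.space i.castSucc` is the
preceding member. -/

/-- A row strict tableau of shape `(n-k, k)`: a filling of the two rows by the numbers
`1, …, n`, each used once, strictly decreasing (from left to right) in each row. -/
@[ext]
structure RowStrictTableau (n k : ℕ) where
  top : Fin (n - k) → Fin n
  bot : Fin k → Fin n
  top_anti : StrictAnti top
  bot_anti : StrictAnti bot
  bij : Function.Bijective (Sum.elim top bot)

namespace RowStrictTableau

variable {n k : ℕ}

/-- A tableau is standard if its columns are strictly decreasing as well. -/
def IsStandard (S : RowStrictTableau n k) : Prop :=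
  ∀ (a : Fin (n - k)) (b : Fin k), (a : ℕ) = (b : ℕ) → S.bot b < S.top a

/-- `w_∧`, the set of the numbers in the top row. -/
def wedge (w : RowStrictTableau n k) : Set (Fin n) := Set.range w.top

/-- `w_∨`, the set of the numbers in the bottom row. -/
def vee (w : RowStrictTableau n k) : Set (Fin n) := Set.range w.bot

/-- `t_i`, the number of the numbers `≤ i` in the top row. -/
def t (w : RowStrictTableau n k) (i : Fin (n + 1)) : ℕ :=
  (Finset.univ.filter fun c : Fin (n - k) => (w.top c : ℕ) < (i : ℕ)).card

/-- `b_i`, the number of the numbers `≤ i` in the bottom row. -/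
def b (w : RowStrictTableau n k) (i : Fin (n + 1)) : ℕ :=
  (Finset.univ.filter fun c : Fin k => (w.bot c : ℕ) < (i : ℕ)).card

/-- The indices of the basis vectors `p_1, …, p_{t_i}, q_1, …, q_{b_i}`. -/
def fixedIndices (w : RowStrictTableau n k) (i : Fin (n + 1)) : Finset (Fin (n - k) ⊕ Fin k) :=
  (Finset.univ.filter fun j : Fin (n - k) => (j : ℕ) < w.t i).disjSum
    (Finset.univ.filter fun j : Fin k => (j : ℕ) < w.b i)

theorem t_add_b (w : RowStrictTableau n k) (i : Fin (n + 1)) : w.t i + w.b i = (i : ℕ) := by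
  classical
  have h1 : w.t i + w.b i
      = (Finset.univ.filter fun x : Fin (n - k) ⊕ Fin k =>
          ((Sum.elim w.top w.bot x : Fin n) : ℕ) < (i : ℕ)).card := by
    unfold t b
    rw [← Finset.card_disjSum]
    congr 1
    ext x
    cases x <;> simp
  have h2 : (Finset.univ.filter fun x : Fin (n - k) ⊕ Fin k =>
          ((Sum.elim w.top w.bot x : Fin n) : ℕ) < (i : ℕ)).card
      = (Finset.univ.filter fun y : Fin n => (y : ℕ) < (i : ℕ)).card :=
    Finset.card_bijective (Sum.elim w.top w.bot) w.bij (by intro x; simp)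
  rw [h1, h2, Fin.card_filter_val_lt]
  have := i.isLt
  omega

theorem card_fixedIndices (w : RowStrictTableau n k) (i : Fin (n + 1)) :
    (w.fixedIndices i).card = (i : ℕ) := by
  have ht : w.t i ≤ n - k := (Finset.card_filter_le _ _).trans (by simp)
  have hb : w.b i ≤ k := (Finset.card_filter_le _ _).trans (by simp)
  rw [fixedIndices, Finset.card_disjSum, Fin.card_filter_val_lt, Fin.card_filter_val_lt,
    min_eq_right ht, min_eq_right hb, t_add_b]

/-- The torus fixed flag of `w`: its `i`-th member is spanned by
`p_1, …, p_{t_i}, q_1, …, q_{b_i}`. -/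
def fixedFlag (w : RowStrictTableau n k) : CompleteFlag n (V n k) where
  space i := Submodule.span ℂ (pq n k '' (w.fixedIndices i : Set (Fin (n - k) ⊕ Fin k)))
  mono i j h := by
    have ht : w.t i ≤ w.t j := Finset.card_le_card (Finset.monotone_filter_right _
      (fun c _ hc => lt_of_lt_of_le hc (Fin.le_def.mp h)))
    have hb : w.b i ≤ w.b j := Finset.card_le_card (Finset.monotone_filter_right _
      (fun c _ hc => lt_of_lt_of_le hc (Fin.le_def.mp h)))
    refine Submodule.span_mono (Set.image_mono (Finset.coe_subset.mpr ?_))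
    refine Finset.disjSum_mono ?_ ?_
    · exact Finset.monotone_filter_right _ (fun c _ hc => lt_of_lt_of_le hc ht)
    · exact Finset.monotone_filter_right _ (fun c _ hc => lt_of_lt_of_le hc hb)
  finrank_eq i := by
    classical
    rw [← Finset.coe_image, finrank_span_finset_eq_card,
      Finset.card_image_of_injective _ (pq n k).injective, card_fixedIndices]
    have h := (pq n k).linearIndependent.linearIndepOn (s := (w.fixedIndices i : Set _))
    rw [Finset.coe_image]
    exact h.id_image

/-- The locally closed set of flags in `Y` attached to a tableau: for each number `i`, lying in
column `c(i)` (counted from `1`), `F_i ⊆ F_{i-1} + im N^{c(i)-1}`. -/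
def openComponent (S : RowStrictTableau n k) : Set (CompleteFlag n (V n k)) :=
  {F | F ∈ springerFiber n k ∧
    (∀ c : Fin (n - k), F.space (S.top c).succ ≤
      F.space (S.top c).castSucc ⊔ LinearMap.range (N n k ^ (c : ℕ))) ∧
    (∀ c : Fin k, F.space (S.bot c).succ ≤
      F.space (S.bot c).castSucc ⊔ LinearMap.range (N n k ^ (c : ℕ)))}

/-- For standard `S`, the irreducible component of the Springer fiber attached to `S`. -/
def component (S : RowStrictTableau n k) : Set (CompleteFlag n (V n k)) :=
  closure S.openComponent

end RowStrictTableau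

/-! ### The torus action and the attracting sets -/

/-- The action of `(r, s) ∈ (ℂˣ)²` on `V`: `p_i ↦ r p_i`, `q_i ↦ s q_i`. -/
def torus (n k : ℕ) (r s : ℂˣ) : V n k ≃ₗ[ℂ] V n k :=
  (pq n k).equiv ((pq n k).unitsSMul (Sum.elim (fun _ => r) (fun _ => s))) (Equiv.refl _)

/-- The filter `t → ∞` on `ℂˣ`. -/
def toInfinity : Filter ℂˣ := comap (fun t : ℂˣ => (t : ℂ)) (Bornology.cobounded ℂ)

/-- The attracting set of the fixed flag of `w` for the cocharacter `t ↦ (t⁻¹, t)`. -/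
def RowStrictTableau.attractingSet {n k : ℕ} (w : RowStrictTableau n k) :
    Set (CompleteFlag n (V n k)) :=
  {F | F ∈ springerFiber n k ∧
    Tendsto (fun t : ℂˣ => F.map (torus n k t⁻¹ t)) toInfinity (𝓝 w.fixedFlag)}

/-- The closure of the attracting set. -/
def RowStrictTableau.stableManifold {n k : ℕ} (w : RowStrictTableau n k) :
    Set (CompleteFlag n (V n k)) :=
  closure w.attractingSet

/-! ### Cup diagrams -/

/-- A crossingless matching (cup diagram) on `n` points: `partner` exchanges the two ends of each
cup and fixes the points carrying a ray. The points strictly below a cup are joined by cups among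
themselves: cups do not cross, and no ray starts below a cup. -/
@[ext]
structure CupDiagram (n : ℕ) where
  partner : Fin n → Fin n
  involutive : Function.Involutive partner
  crossingless : ∀ i j, i < j → j < partner i →
    partner j ≠ j ∧ i < partner j ∧ partner j < partner i

/-- The left ends of the cups. -/
def CupDiagram.leftEnds {n : ℕ} (C : CupDiagram n) : Set (Fin n) := {i | i < C.partner i}

/-- The number of cups. -/
def CupDiagram.numCups {n : ℕ} (C : CupDiagram n) : ℕ := C.leftEnds.ncard

namespace RowStrictTableau

variable {n k : ℕ}

/-- `wC` is oriented: of the two ends of each cup of `C`, one is marked `∧` and one `∨`. -/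
def Orients (w : RowStrictTableau n k) (C : CupDiagram n) : Prop :=
  ∀ i ∈ C.leftEnds, (i ∈ w.vee ∧ C.partner i ∈ w.wedge) ∨ (i ∈ w.wedge ∧ C.partner i ∈ w.vee)

/-- `wC` is oriented with only counter-clockwise cups (left end `∨`, right end `∧`). -/
def OrientsCounterclockwise (w : RowStrictTableau n k) (C : CupDiagram n) : Prop :=
  ∀ i ∈ C.leftEnds, i ∈ w.vee ∧ C.partner i ∈ w.wedge

/-- `C` is the cup diagram associated with `w`: it has the maximal number of cups among
the diagrams which `w` orients with only counter-clockwise cups. -/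
def IsCupDiagram (w : RowStrictTableau n k) (C : CupDiagram n) : Prop :=
  w.OrientsCounterclockwise C ∧
    ∀ D : CupDiagram n, w.OrientsCounterclockwise D → D.numCups ≤ C.numCups

/-- `D` completes `C` to a cup diagram with `k` cups oriented by `w`. -/
def IsCompletion (w : RowStrictTableau n k) (C D : CupDiagram n) : Prop :=
  (∀ i ∈ C.leftEnds, D.partner i = C.partner i) ∧ w.Orients D ∧ D.numCups = k

/-- `S` is the standard tableau of `w`: its bottom row consists of the left ends of the cups in
the completion, with `k` cups, of the cup diagram associated with `w`. -/
def IsStandardTableauOf (w S : RowStrictTableau n k) : Prop :=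
  S.IsStandard ∧ ∃ C D : CupDiagram n,
    w.IsCupDiagram C ∧ w.IsCompletion C D ∧ S.vee = D.leftEnds

end RowStrictTableau

end TwoRowSpringer

end

namespace TwoRowSpringer

noncomputable section

variable {n k : ℕ}

/-! Points are numbered from 0, so a cup with ends `a < b` sits between the members F_a and F_{b+1}
of a flag, written `F.sp a` and `F.sp (b + 1)`. Let P be the span of the p_j.

As t → ∞ the q-directions dominate, so the limit of t·F has members (F_i ∩ P) ⊕ (projection of F_i
along P to the span of the q_j). Hence F in Y is attracted to the fixed flag of w iff these two
pieces are bounded by p_1, …, p_{t_i} and q_1, …, q_{b_i} for all i (`mem_attractingSet_iff`). Since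
t_i + b_i = i, the bounds are then equalities.

Let D be the completed cup diagram of w. A cup spanning 2l points, ends included, gives the closed
relation N^l F_{b+1} ⊆ F_a (`CupRel`). The centre of the proof is `Adapted.stableManifold_eq`: Y_w
is the closed set Z of the flags in Y that satisfy all cup relations and agree with the fixed flag
just after the left ends of clockwise cups. Only the properties of D collected in `Adapted` are
used.

Attracted flags lie in Z. Counter-clockwise cups are handled from the inside outwards: the right end
adjoins a basis vector of P, which N^l pushes into F_a. At a clockwise cup the flag is forced to be
the fixed flag on the left, while the members on the right are forced into images of powers of N;
together these give the relation.

Z lies in the closure. On Z all bounds follow from the P-bound just after the left ends of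
counter-clockwise cups (`Adapted.bounds_of_generic`). If it fails at `a`, the members strictly
between F_a and F_{b+1} are moved by 1 + εφ, where φ commutes with N modulo F_a. The result stays in
Z, is generic at `a` for ε ≠ 0, and is unchanged to the left of the cup. The left ends are treated
from left to right.

If the bottom row of S is the set of left ends of D, all cups are counter-clockwise for S, and Z for
S is cut out of Y by the cup relations alone. The attracting set of S is contained in the open set
defining the component, which satisfies the cup relations; so the component equals Z for S
(`IsStandard.component_eq`). Comparing the sets Z for w and for S(w), with the same D, proves the
theorem.

Combinatorially, maximality means that every ∧-ray lies left of every ∨-ray, and a cup starting at ∨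
ends where the numbers of ∧ and ∨ first balance. The cups added in the completion start at the
rightmost ∧-rays. This makes S(w) unique; for standard w no clockwise cup is added, whence the last
assertion. -/

/-- The coefficient of `p_{j+1}` in a vector, zero if there is no such basis vector. -/
def coordP (n k j : ℕ) : V n k →ₗ[ℂ] ℂ :=
  if h : j < n - k then (pq n k).coord (Sum.inl ⟨j, h⟩) else 0

/-- The coefficient of `q_{j+1}` in a vector, zero if there is no such basis vector. -/
def coordQ (n k j : ℕ) : V n k →ₗ[ℂ] ℂ :=
  if h : j < k then (pq n k).coord (Sum.inr ⟨j, h⟩) else 0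

/-! ### Coordinates and the powers of `N`. -/

theorem pq_coord (i : Fin (n - k) ⊕ Fin k) (v : V n k) : (pq n k).coord i v = v i := by
  simp [pq]

theorem coordP_of_lt {j : ℕ} (h : j < n - k) (v : V n k) :
    coordP n k j v = v (Sum.inl ⟨j, h⟩) := by
  rw [coordP, dif_pos h, pq_coord]

theorem coordP_of_le {j : ℕ} (h : n - k ≤ j) (v : V n k) : coordP n k j v = 0 := by
  rw [coordP, dif_neg (by omega)]; rfl

theorem coordQ_of_lt {j : ℕ} (h : j < k) (v : V n k) :
    coordQ n k j v = v (Sum.inr ⟨j, h⟩) := by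
  rw [coordQ, dif_pos h, pq_coord]

theorem coordQ_of_le {j : ℕ} (h : k ≤ j) (v : V n k) : coordQ n k j v = 0 := by
  rw [coordQ, dif_neg (by omega)]; rfl

theorem coord_ext {v u : V n k} (hP : ∀ j, coordP n k j v = coordP n k j u)
    (hQ : ∀ j, coordQ n k j v = coordQ n k j u) : v = u := by
  ext i
  rcases i with i | i
  · simpa [coordP_of_lt i.isLt] using hP i
  · simpa [coordQ_of_lt i.isLt] using hQ i

theorem exists_coord (c d : ℕ → ℂ) (hc : ∀ j, n - k ≤ j → c j = 0) (hd : ∀ j, k ≤ j → d j = 0) :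
    ∃ v : V n k, (∀ j, coordP n k j v = c j) ∧ ∀ j, coordQ n k j v = d j := by
  refine ⟨WithLp.toLp 2 (Sum.elim (fun j => c j) (fun j => d j)), fun j => ?_, fun j => ?_⟩
  · rcases lt_or_ge j (n - k) with h | h
    · simp [coordP_of_lt h]
    · rw [coordP_of_le h, hc j h]
  · rcases lt_or_ge j k with h | h
    · simp [coordQ_of_lt h]
    · rw [coordQ_of_le h, hd j h]

theorem coordP_pq_inl (j : ℕ) (i : Fin (n - k)) :
    coordP n k j (pq n k (Sum.inl i)) = if (i : ℕ) = j then 1 else 0 := by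
  rcases lt_or_ge j (n - k) with h | h
  · rw [coordP, dif_pos h, Module.Basis.coord_apply, Module.Basis.repr_self, Finsupp.single_apply]
    simp [Fin.ext_iff]
  · rw [coordP_of_le h, if_neg (by omega)]

theorem coordP_pq_inr (j : ℕ) (i : Fin k) : coordP n k j (pq n k (Sum.inr i)) = 0 := by
  rcases lt_or_ge j (n - k) with h | h
  · rw [coordP, dif_pos h, Module.Basis.coord_apply, Module.Basis.repr_self, Finsupp.single_apply]
    simp
  · rw [coordP_of_le h]

theorem coordQ_pq_inr (j : ℕ) (i : Fin k) :
    coordQ n k j (pq n k (Sum.inr i)) = if (i : ℕ) = j then 1 else 0 := by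
  rcases lt_or_ge j k with h | h
  · rw [coordQ, dif_pos h, Module.Basis.coord_apply, Module.Basis.repr_self, Finsupp.single_apply]
    simp [Fin.ext_iff]
  · rw [coordQ_of_le h, if_neg (by omega)]

theorem coordQ_pq_inl (j : ℕ) (i : Fin (n - k)) : coordQ n k j (pq n k (Sum.inl i)) = 0 := by
  rcases lt_or_ge j k with h | h
  · rw [coordQ, dif_pos h, Module.Basis.coord_apply, Module.Basis.repr_self, Finsupp.single_apply]
    simp
  · rw [coordQ_of_le h]

theorem coordP_N (j : ℕ) (v : V n k) : coordP n k j (N n k v) = coordP n k (j + 1) v := by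
  suffices h : coordP n k j ∘ₗ N n k = coordP n k (j + 1) from LinearMap.congr_fun h v
  refine (pq n k).ext fun i => ?_
  rw [LinearMap.comp_apply, N, Module.Basis.constr_basis]
  rcases i with i | i
  · simp only [Sum.elim_inl]
    split_ifs with h
    · simp [coordP_pq_inl, h]
    · rw [coordP_pq_inl, coordP_pq_inl]
      congr 1
      simp only [eq_iff_iff]
      omega
  · simp only [Sum.elim_inr]
    split_ifs with h
    · simp [coordP_pq_inr]
    · rw [coordP_pq_inr, coordP_pq_inr]

theorem coordQ_N (j : ℕ) (v : V n k) : coordQ n k j (N n k v) = coordQ n k (j + 1) v := by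
  suffices h : coordQ n k j ∘ₗ N n k = coordQ n k (j + 1) from LinearMap.congr_fun h v
  refine (pq n k).ext fun i => ?_
  rw [LinearMap.comp_apply, N, Module.Basis.constr_basis]
  rcases i with i | i
  · simp only [Sum.elim_inl]
    split_ifs with h
    · simp [coordQ_pq_inl]
    · rw [coordQ_pq_inl, coordQ_pq_inl]
  · simp only [Sum.elim_inr]
    split_ifs with h
    · simp [coordQ_pq_inr, h]
    · rw [coordQ_pq_inr, coordQ_pq_inr]
      congr 1
      simp only [eq_iff_iff]
      omega

theorem coordP_N_pow (l j : ℕ) (v : V n k) :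
    coordP n k j ((N n k ^ l) v) = coordP n k (j + l) v := by
  induction l generalizing j with
  | zero => simp
  | succ l ih => rw [pow_succ', Module.End.mul_apply, coordP_N, ih, add_right_comm, add_assoc]

theorem coordQ_N_pow (l j : ℕ) (v : V n k) :
    coordQ n k j ((N n k ^ l) v) = coordQ n k (j + l) v := by
  induction l generalizing j with
  | zero => simp
  | succ l ih => rw [pow_succ', Module.End.mul_apply, coordQ_N, ih, add_right_comm, add_assoc]

theorem N_pow_N_pow (l m : ℕ) (v : V n k) :
    (N n k ^ l) ((N n k ^ m) v) = (N n k ^ (l + m)) v := by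
  rw [pow_add, Module.End.mul_apply]

/-- `N ^ l` shifts coordinates by `l`, so a vector it kills is determined by its first `l`
coefficients in each of the two rows. -/
theorem finrank_ker_N_pow_le (l : ℕ) : Module.finrank ℂ (LinearMap.ker (N n k ^ l)) ≤ 2 * l := by
  let f : V n k →ₗ[ℂ] (Fin l ⊕ Fin l → ℂ) := LinearMap.pi
    (Sum.elim (fun j => coordP n k j) (fun j => coordQ n k j))
  have hf : Function.Injective (f ∘ₗ (LinearMap.ker (N n k ^ l)).subtype) := by
    rw [← LinearMap.ker_eq_bot, LinearMap.ker_eq_bot']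
    rintro ⟨v, hv⟩ h
    rw [LinearMap.mem_ker] at hv
    ext1
    refine coord_ext (fun j => ?_) (fun j => ?_)
    · rcases lt_or_ge j l with hj | hj
      · simpa [f] using congrFun h (Sum.inl ⟨j, hj⟩)
      · obtain ⟨i, rfl⟩ := Nat.exists_eq_add_of_le' hj
        rw [← coordP_N_pow, hv]; simp
    · rcases lt_or_ge j l with hj | hj
      · simpa [f] using congrFun h (Sum.inr ⟨j, hj⟩)
      · obtain ⟨i, rfl⟩ := Nat.exists_eq_add_of_le' hj
        rw [← coordQ_N_pow, hv]; simp
  have := LinearMap.finrank_le_finrank_of_injective hf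
  simpa [two_mul] using this

theorem finrank_map_add_finrank_ker_inf {W : Type*} [AddCommGroup W] [Module ℂ W]
    [FiniteDimensional ℂ W] (f : W →ₗ[ℂ] W) (E : Submodule ℂ W) :
    Module.finrank ℂ (E.map f) + Module.finrank ℂ (E ⊓ LinearMap.ker f : Submodule ℂ W)
      = Module.finrank ℂ E := by
  have h := LinearMap.finrank_range_add_finrank_ker (f.domRestrict E)
  rw [LinearMap.range_domRestrict, LinearMap.ker_domRestrict] at h
  rw [← h, ← Submodule.map_comap_subtype, Submodule.finrank_map_subtype_eq]

theorem finrank_le_finrank_map_N_pow (l : ℕ) (E : Submodule ℂ (V n k)) :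
    Module.finrank ℂ E ≤ Module.finrank ℂ (E.map (N n k ^ l)) + 2 * l := by
  rw [← finrank_map_add_finrank_ker_inf (N n k ^ l) E]
  have := Submodule.finrank_mono (inf_le_right : E ⊓ LinearMap.ker (N n k ^ l) ≤ _)
  have := finrank_ker_N_pow_le (n := n) (k := k) l
  omega

theorem finrank_comap_add {W : Type*} [AddCommGroup W] [Module ℂ W]
    [FiniteDimensional ℂ W] (f : W →ₗ[ℂ] W) (U : Submodule ℂ W) :
    Module.finrank ℂ (U.comap f) = Module.finrank ℂ (U ⊓ LinearMap.range f : Submodule ℂ W)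
      + Module.finrank ℂ (LinearMap.ker f) := by
  have h := finrank_map_add_finrank_ker_inf f (U.comap f)
  rw [Submodule.map_comap_eq, inf_eq_right.mpr (LinearMap.ker_le_comap f), inf_comm] at h
  exact h.symm

/-! ### Flags indexed by natural numbers -/

/-- The member of dimension `i` of a flag; the whole space for `i ≥ n`. -/
def CompleteFlag.sp {W : Type*} [AddCommGroup W] [Module ℂ W] (F : CompleteFlag n W) (i : ℕ) :
    Submodule ℂ W :=
  F.space ⟨min i n, by omega⟩

section
variable {W : Type*} [AddCommGroup W] [Module ℂ W]

theorem CompleteFlag.sp_val (F : CompleteFlag n W) (i : Fin (n + 1)) :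
    F.sp i = F.space i := by
  unfold CompleteFlag.sp
  congr 1
  ext
  simp; omega

theorem CompleteFlag.sp_succ (F : CompleteFlag n W) (i : Fin n) :
    F.sp (i + 1) = F.space i.succ := F.sp_val i.succ

theorem CompleteFlag.sp_castSucc (F : CompleteFlag n W) (i : Fin n) :
    F.sp i = F.space i.castSucc := F.sp_val i.castSucc

theorem CompleteFlag.sp_mono (F : CompleteFlag n W) {i j : ℕ} (h : i ≤ j) : F.sp i ≤ F.sp j :=
  F.mono (by rw [Fin.le_def]; simp; omega)

theorem CompleteFlag.finrank_sp (F : CompleteFlag n W) {i : ℕ} (h : i ≤ n) :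
    Module.finrank ℂ (F.sp i) = i := by
  rw [CompleteFlag.sp, F.finrank_eq]; simp [h]

theorem CompleteFlag.sp_eq_of_le [FiniteDimensional ℂ W] (F : CompleteFlag n W) {i : ℕ}
    (hi : i ≤ n) {U : Submodule ℂ W} (hU : Module.finrank ℂ U ≤ i) (h : F.sp i ≤ U) : F.sp i = U :=
  Submodule.eq_of_le_of_finrank_le h (by rwa [F.finrank_sp hi])

theorem CompleteFlag.sp_succ_eq_sup [FiniteDimensional ℂ W] (F : CompleteFlag n W) {i : ℕ}
    (hi : i < n) {x : W} (hx : x ∈ F.sp (i + 1)) (hx' : x ∉ F.sp i) : F.sp (i + 1) = F.sp i ⊔ Submodule.span ℂ {x} := by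
  symm
  refine Submodule.eq_of_le_of_finrank_le (sup_le (F.sp_mono (Nat.le_succ i))
    (by simpa using hx)) ?_
  rw [F.finrank_sp (by omega)]
  have h1 : F.sp i < F.sp i ⊔ Submodule.span ℂ {x} := by
    refine lt_of_le_of_ne le_sup_left fun h => hx' ?_
    rw [h]
    exact Submodule.mem_sup_right (Submodule.mem_span_singleton_self x)
  have := Submodule.finrank_lt_finrank_of_lt h1
  rw [F.finrank_sp (by omega)] at this
  omega

end

theorem finrank_V (h : k ≤ n) : Module.finrank ℂ (V n k) = n := by
  simp [h]

theorem CompleteFlag.sp_zero (F : CompleteFlag n (V n k)) : F.sp 0 = ⊥ := by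
  rw [← Submodule.finrank_eq_zero, F.finrank_sp (Nat.zero_le _)]

theorem CompleteFlag.sp_of_le (F : CompleteFlag n (V n k)) (hk : k ≤ n) {i : ℕ} (h : n ≤ i) :
    F.sp i = ⊤ := by
  have : F.sp i = F.sp n := by unfold CompleteFlag.sp; congr 2; omega
  rw [this]
  exact Submodule.eq_top_of_finrank_eq (by rw [F.finrank_sp le_rfl, finrank_V hk])

theorem mem_springerFiber_iff (hk : k ≤ n) {F : CompleteFlag n (V n k)} :
    F ∈ springerFiber n k ↔ ∀ (i : ℕ), ∀ v ∈ F.sp (i + 1), N n k v ∈ F.sp i := by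
  constructor
  · intro hF i v hv
    rcases lt_or_ge i n with h | h
    · have := hF ⟨i, h⟩
      rw [← F.sp_succ, ← F.sp_castSucc] at this
      exact this (Submodule.mem_map_of_mem hv)
    · rw [F.sp_of_le hk h]; trivial
  · intro hF i
    rw [← F.sp_succ, ← F.sp_castSucc]
    rintro _ ⟨v, hv, rfl⟩
    exact hF i v hv

/-! ### Convergence of flags -/

section Topology

variable {W : Type*} [NormedAddCommGroup W] [InnerProductSpace ℂ W] [FiniteDimensional ℂ W]

theorem trace_starProjection (U : Submodule ℂ W) :
    LinearMap.trace ℂ W (U.starProjection : W →ₗ[ℂ] W) = Module.finrank ℂ U :=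
  LinearMap.IsProj.trace ⟨fun _ => Submodule.starProjection_apply_mem _ _,
    fun _ h => Submodule.starProjection_eq_self_iff.mpr h⟩

/-- In finite dimension an operator is a linear, hence continuous, function of its values on a
basis. -/
theorem tendsto_clm_of_pointwise {α ι : Type*} {l : Filter α} [Fintype ι]
    (e : OrthonormalBasis ι ℂ W) {f : α → W →L[ℂ] W} {g : W →L[ℂ] W}
    (h : ∀ i, Tendsto (fun a => f a (e i)) l (𝓝 (g (e i)))) : Tendsto f l (𝓝 g) := by
  let B : (ι → W) →ₗ[ℂ] (W →L[ℂ] W) :=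
    (LinearMap.toContinuousLinearMap : (W →ₗ[ℂ] W) ≃ₗ[ℂ] (W →L[ℂ] W)).toLinearMap ∘ₗ
      (e.toBasis.constr ℂ).toLinearMap
  have hB : Continuous B := B.continuous_of_finiteDimensional
  have key : ∀ T : W →L[ℂ] W, B (fun i => T (e i)) = T := by
    intro T
    ext1 x
    have : (e.toBasis.constr ℂ) (fun i => T (e i)) = (T : W →ₗ[ℂ] W) := by
      refine e.toBasis.ext fun i => ?_
      rw [Module.Basis.constr_basis]
      simp
    change (e.toBasis.constr ℂ) (fun i => T (e i)) x = T x
    rw [this]; rfl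
  have h1 : Tendsto (fun a i => f a (e i)) l (𝓝 fun i => g (e i)) := tendsto_pi_nhds.mpr h
  have h2 := (hB.tendsto _).comp h1
  rw [key] at h2
  refine h2.congr fun a => ?_
  exact key (f a)

/-- Approximating the vectors of the limit suffices once dimensions agree: the squared
Hilbert–Schmidt distance of two projections of rank d is 2d − 2 Re tr(P_U P_L), and the trace tends
to d because P_U v → v for v in L. -/
theorem tendsto_starProjection {α : Type*} {l : Filter α} {U : α → Submodule ℂ W}
    {L : Submodule ℂ W} (hd : ∀ a, Module.finrank ℂ (U a) = Module.finrank ℂ L)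
    (h : ∀ v ∈ L, ∃ u : α → W, (∀ᶠ a in l, u a ∈ U a) ∧ Tendsto u l (𝓝 v)) :
    Tendsto (fun a => ((U a).starProjection : W →L[ℂ] W)) l (𝓝 L.starProjection) := by
  have h1 : ∀ v ∈ L, Tendsto (fun a => (U a).starProjection v) l (𝓝 v) := by
    intro v hv
    obtain ⟨u, hu, hlim⟩ := h v hv
    have h0 : Tendsto (fun a => (U a).starProjection (v - u a)) l (𝓝 0) := by
      refine squeeze_zero_norm (fun a => (U a).norm_starProjection_apply_le _) ?_
      have := (tendsto_const_nhds (x := v)).sub hlim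
      simpa using this.norm
    have h2 := h0.add hlim
    rw [zero_add] at h2
    refine h2.congr' ?_
    filter_upwards [hu] with a ha
    rw [map_sub, Submodule.starProjection_eq_self_iff.mpr ha, sub_add_cancel]
  let e := stdOrthonormalBasis ℂ W
  have htr : ∀ M : Submodule ℂ W, ∑ i, inner ℂ (e i) (M.starProjection (e i))
      = (Module.finrank ℂ M : ℂ) := by
    intro M
    rw [← trace_starProjection M, LinearMap.trace_eq_sum_inner _ e]
    rfl
  have h2 : Tendsto (fun a => ∑ i, ‖(U a).starProjection (e i) - L.starProjection (e i)‖ ^ 2) l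
      (𝓝 0) := by
    have h3 : ∀ a, ∑ i, ‖(U a).starProjection (e i) - L.starProjection (e i)‖ ^ 2
        = 2 * Module.finrank ℂ L
          - 2 * (∑ i, inner ℂ (e i) ((U a).starProjection (L.starProjection (e i)))).re := by
      intro a
      have hs : ∀ (M : Submodule ℂ W) x, ‖M.starProjection x‖ ^ 2
          = (inner ℂ x (M.starProjection x) : ℂ).re := by
        intro M x
        rw [← Submodule.starProjection_eq_self_iff.mpr (M.starProjection_apply_mem x),
          ← M.inner_starProjection_left_eq_right,
          Submodule.starProjection_eq_self_iff.mpr (M.starProjection_apply_mem x)]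
        exact (inner_self_eq_norm_sq (𝕜 := ℂ) _).symm
      have hsum : ∀ M : Submodule ℂ W, ∑ i, ‖M.starProjection (e i)‖ ^ 2
          = Module.finrank ℂ M := by
        intro M
        simp_rw [hs, ← Complex.re_sum, htr]
        simp
      calc _ = ∑ i, (‖(U a).starProjection (e i)‖ ^ 2 + ‖L.starProjection (e i)‖ ^ 2
            - 2 * (inner ℂ (e i) ((U a).starProjection (L.starProjection (e i))) : ℂ).re) := by
            refine Finset.sum_congr rfl fun i _ => ?_
            rw [norm_sub_sq (𝕜 := ℂ), ← (U a).inner_starProjection_left_eq_right]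
            simp only [RCLike.re_to_complex]
            ring
        _ = _ := by
            rw [Finset.sum_sub_distrib, Finset.sum_add_distrib, hsum, hsum, hd,
              ← Finset.mul_sum, Complex.re_sum]
            ring
    simp_rw [h3]
    have h4 : Tendsto (fun a => (∑ i, inner ℂ (e i)
        ((U a).starProjection (L.starProjection (e i))) : ℂ).re) l
        (𝓝 (Module.finrank ℂ L : ℂ).re) := by
      rw [← htr L]
      refine (Complex.continuous_re.tendsto _).comp (tendsto_finsetSum _ fun i _ => ?_)
      exact (tendsto_const_nhds).inner (h1 _ (L.starProjection_apply_mem _))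
    have h5 := (tendsto_const_nhds (x := (2 * Module.finrank ℂ L : ℝ))).sub (h4.const_mul 2)
    simpa using h5
  refine tendsto_clm_of_pointwise e fun i => ?_
  rw [tendsto_iff_norm_sub_tendsto_zero]
  have h6 : Tendsto (fun a => ‖(U a).starProjection (e i) - L.starProjection (e i)‖ ^ 2) l
      (𝓝 0) := by
    refine squeeze_zero (fun a => by positivity) (fun a => ?_) h2
    exact Finset.single_le_sum
      (f := fun i => ‖(U a).starProjection (e i) - L.starProjection (e i)‖ ^ 2)
      (fun _ _ => by positivity) (Finset.mem_univ i)
  have h7 := (Real.continuous_sqrt.tendsto _).comp h6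
  rw [Real.sqrt_zero] at h7
  refine h7.congr fun a => ?_
  exact Real.sqrt_sq (norm_nonneg _)

theorem tendsto_flag_iff {α : Type*} {l : Filter α} {f : α → CompleteFlag n W}
    {L : CompleteFlag n W} : Tendsto f l (𝓝 L) ↔
      ∀ i, Tendsto (fun a => ((f a).space i).starProjection) l (𝓝 (L.space i).starProjection) := by
  rw [nhds_induced, tendsto_comap_iff, tendsto_pi_nhds]
  rfl

theorem tendsto_flag {α : Type*} {l : Filter α} {f : α → CompleteFlag n W}
    {L : CompleteFlag n W} (h : ∀ i ≤ n, ∀ v ∈ L.sp i,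
      ∃ u : α → W, (∀ᶠ a in l, u a ∈ (f a).sp i) ∧ Tendsto u l (𝓝 v)) : Tendsto f l (𝓝 L) := by
  rw [tendsto_flag_iff]
  intro i
  refine tendsto_starProjection (fun a => by rw [CompleteFlag.finrank_eq, CompleteFlag.finrank_eq])
    fun v hv => ?_
  simp_rw [← CompleteFlag.sp_val] at hv ⊢
  exact h i (by omega) v hv

theorem continuous_starProjection_sp (i : ℕ) :
    Continuous fun F : CompleteFlag n W => (F.sp i).starProjection :=
  continuous_iff_continuousAt.mpr fun _ => tendsto_flag_iff.mp tendsto_id ⟨min i n, by omega⟩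

/-- Membership means being fixed by the projection, and applying a projection is jointly continuous
in the projection and the vector. -/
theorem mem_sp_of_tendsto {α : Type*} {l : Filter α} [l.NeBot] {f : α → CompleteFlag n W}
    {L : CompleteFlag n W} (h : Tendsto f l (𝓝 L)) {i : ℕ} {u : α → W} {v : W}
    (hu : ∀ᶠ a in l, u a ∈ (f a).sp i) (hv : Tendsto u l (𝓝 v)) : v ∈ L.sp i := by
  have h1 := ((continuous_starProjection_sp i).tendsto L).comp h
  have h2 : Tendsto (fun a => ((f a).sp i).starProjection (u a)) l
      (𝓝 ((L.sp i).starProjection v)) :=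
    (isBoundedBilinearMap_apply.continuous.tendsto
      ((L.sp i).starProjection, v)).comp (h1.prodMk_nhds hv)
  have h3 : Tendsto u l (𝓝 ((L.sp i).starProjection v)) := by
    refine h2.congr' ?_
    filter_upwards [hu] with a ha
    exact Submodule.starProjection_eq_self_iff.mpr ha
  exact Submodule.starProjection_eq_self_iff.mp (tendsto_nhds_unique h3 hv)

theorem isClosed_setOf_map_sp_le (A : W →ₗ[ℂ] W) (i j : ℕ) :
    IsClosed {F : CompleteFlag n W | ∀ v ∈ F.sp i, A v ∈ F.sp j} := by
  have h : {F : CompleteFlag n W | ∀ v ∈ F.sp i, A v ∈ F.sp j}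
      = ⋂ v, {F : CompleteFlag n W |
        (F.sp j).starProjection (A ((F.sp i).starProjection v)) = A ((F.sp i).starProjection v)} := by
    ext F
    simp only [Set.mem_ofPred_eq, Set.mem_iInter, Submodule.starProjection_eq_self_iff]
    constructor
    · intro h v
      exact h _ (Submodule.starProjection_apply_mem _ _)
    · intro h v hv
      have := h v
      rwa [Submodule.starProjection_eq_self_iff.mpr hv] at this
  rw [h]
  refine isClosed_iInter fun v => ?_
  have h1 : Continuous fun F : CompleteFlag n W => A ((F.sp i).starProjection v) :=
    A.continuous_of_finiteDimensional.comp ((continuous_starProjection_sp i).clm_apply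
      continuous_const)
  exact isClosed_eq ((continuous_starProjection_sp j).clm_apply h1) h1

theorem isClosed_setOf_sp_le (U : Submodule ℂ W) (i : ℕ) :
    IsClosed {F : CompleteFlag n W | F.sp i ≤ U} := by
  have h : {F : CompleteFlag n W | F.sp i ≤ U}
      = ⋂ v, {F : CompleteFlag n W | (F.sp i).starProjection v ∈ U} := by
    ext F
    simp only [Set.mem_ofPred_eq, Set.mem_iInter]
    constructor
    · intro h v
      exact h (Submodule.starProjection_apply_mem _ _)
    · intro h v hv
      have := h v
      rwa [Submodule.starProjection_eq_self_iff.mpr hv] at this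
  rw [h]
  refine isClosed_iInter fun v => ?_
  exact U.closed_of_finiteDimensional.preimage
    ((continuous_starProjection_sp i).clm_apply continuous_const)

end Topology

/-! ### Counting entries of a tableau -/

/-- The number of the elements of `A` preceding `i`. -/
def countBelow (A : Set (Fin n)) (i : ℕ) : ℕ := {j : Fin n | (j : ℕ) < i ∧ j ∈ A}.ncard

theorem countBelow_add {A : Set (Fin n)} {x y : ℕ} (h : x ≤ y) :
    countBelow A y = countBelow A x + {j : Fin n | x ≤ (j : ℕ) ∧ (j : ℕ) < y ∧ j ∈ A}.ncard := by
  rw [countBelow, countBelow, ← Set.ncard_union_eq]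
  · congr 1
    ext j
    simp only [Set.mem_ofPred_eq, Set.mem_union]
    by_cases hj : j ∈ A <;> simp [hj]; omega
  · rw [Set.disjoint_left]
    rintro j ⟨h1, -⟩ ⟨h2, -⟩
    omega

theorem countBelow_mono (A : Set (Fin n)) {x y : ℕ} (h : x ≤ y) :
    countBelow A x ≤ countBelow A y := by
  rw [countBelow_add h]; omega

theorem countBelow_zero (A : Set (Fin n)) : countBelow A 0 = 0 := by
  simp [countBelow]

theorem countBelow_succ_of_mem {A : Set (Fin n)} {j : Fin n} (hj : j ∈ A) :
    countBelow A (j + 1) = countBelow A j + 1 := by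
  rw [countBelow_add (Nat.le_succ (j : ℕ))]
  congr 1
  rw [Set.ncard_eq_one]
  refine ⟨j, ?_⟩
  ext i
  simp only [Set.mem_ofPred_eq, Set.mem_singleton_iff]
  constructor
  · rintro ⟨h1, h2, -⟩
    exact Fin.ext (by omega)
  · rintro rfl
    exact ⟨le_rfl, Nat.lt_succ_self _, hj⟩

theorem countBelow_succ_of_notMem {A : Set (Fin n)} {j : Fin n} (hj : j ∉ A) :
    countBelow A (j + 1) = countBelow A j := by
  rw [countBelow_add (Nat.le_succ (j : ℕ)), Nat.add_eq_left, Set.ncard_eq_zero]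
  ext i
  simp only [Set.mem_ofPred_eq, Set.mem_empty_iff_false, iff_false]
  rintro ⟨h1, h2, h3⟩
  exact hj (by convert h3; omega)

namespace RowStrictTableau

variable (w : RowStrictTableau n k)

/-- The number of the entries of the top row preceding `i`. -/
def tN (i : ℕ) : ℕ := countBelow w.wedge i

/-- The number of the entries of the bottom row preceding `i`. -/
def bN (i : ℕ) : ℕ := countBelow w.vee i

variable {w}

theorem mem_wedge_or_mem_vee (i : Fin n) : i ∈ w.wedge ∨ i ∈ w.vee := by
  obtain ⟨x | x, hx⟩ := w.bij.surjective i
  · exact Or.inl ⟨x, hx⟩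
  · exact Or.inr ⟨x, hx⟩

theorem notMem_vee_of_mem_wedge {i : Fin n} (h : i ∈ w.wedge) : i ∉ w.vee := by
  obtain ⟨x, hx⟩ := h
  rintro ⟨y, hy⟩
  have : (Sum.inl x : Fin (n - k) ⊕ Fin k) = Sum.inr y := w.bij.injective (by simp [hx, hy])
  simp at this

theorem notMem_wedge_iff {i : Fin n} : i ∉ w.wedge ↔ i ∈ w.vee :=
  ⟨fun h => (mem_wedge_or_mem_vee i).resolve_left h, fun h h' => notMem_vee_of_mem_wedge h' h⟩

theorem notMem_vee_iff {i : Fin n} : i ∉ w.vee ↔ i ∈ w.wedge := by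
  rw [← notMem_wedge_iff, not_not]

theorem card_filter_lt_eq_countBelow {m : ℕ} {f : Fin m → Fin n} (hf : Function.Injective f) (i : ℕ) :
    (Finset.univ.filter fun c => (f c : ℕ) < i).card = countBelow (Set.range f) i := by
  rw [countBelow, ← Set.ncard_coe_finset, ← Set.ncard_image_of_injective _ hf]
  congr 1
  ext j
  simp only [Finset.coe_filter, Finset.mem_univ, true_and, Set.mem_image, Set.mem_ofPred_eq,
    Set.mem_range]
  constructor
  · rintro ⟨c, h, rfl⟩
    exact ⟨h, c, rfl⟩
  · rintro ⟨h, c, rfl⟩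
    exact ⟨c, h, rfl⟩

theorem t_eq_tN (i : Fin (n + 1)) : w.t i = w.tN i :=
  card_filter_lt_eq_countBelow w.top_anti.injective i

theorem b_eq_bN (i : Fin (n + 1)) : w.b i = w.bN i :=
  card_filter_lt_eq_countBelow w.bot_anti.injective i

theorem tN_add_bN {i : ℕ} (h : i ≤ n) : w.tN i + w.bN i = i := by
  have := w.t_add_b ⟨i, by omega⟩
  rwa [t_eq_tN, b_eq_bN] at this

theorem card_le (w : RowStrictTableau n k) : k ≤ n := by
  simpa using Fintype.card_le_of_injective _ w.bot_anti.injective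

theorem tN_le (i : ℕ) : w.tN i ≤ n - k := by
  rw [tN, wedge, ← card_filter_lt_eq_countBelow w.top_anti.injective]
  exact (Finset.card_filter_le _ _).trans (by simp)

theorem bN_le (i : ℕ) : w.bN i ≤ k := by
  rw [bN, vee, ← card_filter_lt_eq_countBelow w.bot_anti.injective]
  exact (Finset.card_filter_le _ _).trans (by simp)

theorem tN_last : w.tN n = n - k := by
  have h1 := w.tN_add_bN le_rfl
  have h2 := w.tN_le n
  have h3 := w.bN_le n
  have := w.card_le
  omega

theorem bN_last : w.bN n = k := by
  have h1 := w.tN_add_bN le_rfl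
  have h2 := w.tN_le n
  have h3 := w.bN_le n
  have := w.card_le
  omega

theorem tN_succ_of_mem_wedge {j : Fin n} (h : j ∈ w.wedge) : w.tN (j + 1) = w.tN j + 1 :=
  countBelow_succ_of_mem h

theorem bN_succ_of_mem_wedge {j : Fin n} (h : j ∈ w.wedge) : w.bN (j + 1) = w.bN j :=
  countBelow_succ_of_notMem (notMem_vee_of_mem_wedge h)

theorem tN_succ_of_mem_vee {j : Fin n} (h : j ∈ w.vee) : w.tN (j + 1) = w.tN j :=
  countBelow_succ_of_notMem (notMem_wedge_iff.mpr h)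

theorem bN_succ_of_mem_vee {j : Fin n} (h : j ∈ w.vee) : w.bN (j + 1) = w.bN j + 1 :=
  countBelow_succ_of_mem h

theorem tN_top (c : Fin (n - k)) : w.tN (w.top c) + c + 1 = n - k := by
  rw [tN, wedge, ← card_filter_lt_eq_countBelow w.top_anti.injective]
  have : (Finset.univ.filter fun d => (w.top d : ℕ) < (w.top c : ℕ)) = Finset.Ioi c := by
    ext d
    simp [w.top_anti.lt_iff_gt]
  rw [this, Fin.card_Ioi]
  omega

theorem bN_bot (c : Fin k) : w.bN (w.bot c) + c + 1 = k := by
  rw [bN, vee, ← card_filter_lt_eq_countBelow w.bot_anti.injective]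
  have : (Finset.univ.filter fun d => (w.bot d : ℕ) < (w.bot c : ℕ)) = Finset.Ioi c := by
    ext d
    simp [w.bot_anti.lt_iff_gt]
  rw [this, Fin.card_Ioi]
  omega

theorem mem_fixedFlag_sp {i : ℕ} (hi : i ≤ n) {v : V n k} : v ∈ w.fixedFlag.sp i ↔
    (∀ j, w.tN i ≤ j → coordP n k j v = 0) ∧ ∀ j, w.bN i ≤ j → coordQ n k j v = 0 := by
  have h1 : w.fixedFlag.sp i = Submodule.span ℂ
      (pq n k '' (w.fixedIndices ⟨i, by omega⟩ : Set (Fin (n - k) ⊕ Fin k))) :=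
    w.fixedFlag.sp_val ⟨i, by omega⟩
  have h2 : ∀ x, (pq n k).repr v x = v x := fun x => pq_coord x v
  rw [h1, Module.Basis.mem_span_image]
  simp only [Set.subset_def, Finset.mem_coe, Finsupp.mem_support_iff, h2, fixedIndices, t_eq_tN,
    b_eq_bN]
  constructor
  · intro h
    constructor
    · intro j hj
      by_contra hne
      rcases lt_or_ge j (n - k) with hj' | hj'
      · rw [coordP_of_lt hj'] at hne
        have := h _ hne
        simp at this
        omega
      · exact hne (coordP_of_le hj' v)
    · intro j hj
      by_contra hne
      rcases lt_or_ge j k with hj' | hj'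
      · rw [coordQ_of_lt hj'] at hne
        have := h _ hne
        simp at this
        omega
      · exact hne (coordQ_of_le hj' v)
  · rintro ⟨hP, hQ⟩ (x | x) hx
    · simp only [Finset.inl_mem_disjSum, Finset.mem_filter, Finset.mem_univ, true_and]
      by_contra hlt
      have := hP x (by omega)
      rw [coordP_of_lt x.isLt] at this
      exact hx this
    · simp only [Finset.inr_mem_disjSum, Finset.mem_filter, Finset.mem_univ, true_and]
      by_contra hlt
      have := hQ x (by omega)
      rw [coordQ_of_lt x.isLt] at this
      exact hx this

/-! ### The attracting set in coordinates -/

/-- The vectors of `F_i` in the span of the `p_j` lie in the span of `p_1, …, p_{t_i}`. -/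
def BoundP (w : RowStrictTableau n k) (F : CompleteFlag n (V n k)) (i : ℕ) : Prop :=
  ∀ v ∈ F.sp i, (∀ j, coordQ n k j v = 0) → ∀ j, w.tN i ≤ j → coordP n k j v = 0

/-- The projection of `F_i` to the span of the `q_j` lies in the span of `q_1, …, q_{b_i}`. -/
def BoundQ (w : RowStrictTableau n k) (F : CompleteFlag n (V n k)) (i : ℕ) : Prop :=
  ∀ v ∈ F.sp i, ∀ j, w.bN i ≤ j → coordQ n k j v = 0

/-- The q-coordinates map F_i to a space of dimension b_i with kernel F_i ∩ P of dimension at most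
t_i. As t_i + b_i = dim F_i, both bounds are attained. -/
theorem saturated_of_bounds {F : CompleteFlag n (V n k)} {i : ℕ} (hi : i ≤ n)
    (hP : w.BoundP F i) (hQ : w.BoundQ F i) :
    (∀ v, (∀ j, coordQ n k j v = 0) → (∀ j, w.tN i ≤ j → coordP n k j v = 0) → v ∈ F.sp i) ∧
    ∀ d : ℕ → ℂ, (∀ j, w.bN i ≤ j → d j = 0) → ∃ v ∈ F.sp i, ∀ j, coordQ n k j v = d j := by
  let φ : F.sp i →ₗ[ℂ] (Fin (w.bN i) → ℂ) :=
    (LinearMap.pi fun j : Fin (w.bN i) => coordQ n k j) ∘ₗ (F.sp i).subtype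
  let ψ : LinearMap.ker φ →ₗ[ℂ] (Fin (w.tN i) → ℂ) :=
    (LinearMap.pi fun j : Fin (w.tN i) => coordP n k j) ∘ₗ (F.sp i).subtype ∘ₗ
      (LinearMap.ker φ).subtype
  have hker : ∀ v : F.sp i, v ∈ LinearMap.ker φ → ∀ j, coordQ n k j v = 0 := by
    intro v hv j
    rcases lt_or_ge j (w.bN i) with h | h
    · exact congrFun (LinearMap.mem_ker.mp hv) ⟨j, h⟩
    · exact hQ v v.2 j h
  have hψ : Function.Injective ψ := by
    rw [← LinearMap.ker_eq_bot, LinearMap.ker_eq_bot']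
    rintro ⟨v, hv⟩ h
    ext1
    ext1
    have hv' := hker v hv
    refine coord_ext (fun j => ?_) (fun j => ?_)
    · rcases lt_or_ge j (w.tN i) with hj | hj
      · exact (congrFun h ⟨j, hj⟩).trans (by simp)
      · exact (hP v v.2 hv' j hj).trans (by simp)
    · exact (hv' j).trans (by simp)
  have h1 := LinearMap.finrank_le_finrank_of_injective hψ
  have h2 := LinearMap.finrank_range_add_finrank_ker φ
  have h3 := Submodule.finrank_le (LinearMap.range φ)
  have h4 := w.tN_add_bN hi
  rw [F.finrank_sp hi] at h2
  simp only [Module.finrank_fintype_fun_eq_card, Fintype.card_fin] at h1 h3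
  constructor
  · intro v hvQ hvP
    have hs : Function.Surjective ψ :=
      (LinearMap.injective_iff_surjective_of_finrank_eq_finrank
        (by simp only [Module.finrank_fintype_fun_eq_card, Fintype.card_fin]; omega)).mp hψ
    obtain ⟨⟨u, hu⟩, huv⟩ := hs fun j => coordP n k j v
    have : v = u := by
      refine coord_ext (fun j => ?_) (fun j => ?_)
      · rcases lt_or_ge j (w.tN i) with hj | hj
        · exact (congrFun huv ⟨j, hj⟩).symm
        · rw [hvP j hj, hP u u.2 (hker u hu) j hj]
      · rw [hvQ, hker u hu]
    rw [this]
    exact u.2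
  · intro d hd
    have hs : LinearMap.range φ = ⊤ := Submodule.eq_top_of_finrank_eq
      (by simp only [Module.finrank_fintype_fun_eq_card, Fintype.card_fin]; omega)
    obtain ⟨v, hv⟩ := LinearMap.range_eq_top.mp hs fun j => d j
    refine ⟨v, v.2, fun j => ?_⟩
    rcases lt_or_ge j (w.bN i) with h | h
    · exact congrFun hv ⟨j, h⟩
    · rw [hd j h, hQ v v.2 j h]

end RowStrictTableau

theorem exists_add_eq (v : V n k) : ∃ x y : V n k, v = x + y ∧ (∀ j, coordQ n k j x = 0) ∧
    ∀ j, coordP n k j y = 0 := by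
  obtain ⟨x, hx, hx'⟩ := exists_coord (n := n) (k := k) (fun j => coordP n k j v) (fun _ => 0)
    (fun j h => coordP_of_le h v) (fun _ _ => rfl)
  refine ⟨x, v - x, by abel, hx', fun j => ?_⟩
  rw [map_sub, hx, sub_self]

theorem torus_pq (r s : ℂˣ) (i : Fin (n - k) ⊕ Fin k) : torus n k r s (pq n k i)
    = (Sum.elim (fun _ => (r : ℂ)) (fun _ => (s : ℂ)) i) • pq n k i := by
  rw [torus, Module.Basis.equiv_apply, Module.Basis.unitsSMul_apply]
  rcases i with i | i <;> rfl

theorem coordP_torus (r s : ℂˣ) (j : ℕ) (v : V n k) :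
    coordP n k j (torus n k r s v) = r * coordP n k j v := by
  suffices h : coordP n k j ∘ₗ (torus n k r s : V n k →ₗ[ℂ] V n k) = (r : ℂ) • coordP n k j from
    LinearMap.congr_fun h v
  refine (pq n k).ext fun i => ?_
  rw [LinearMap.comp_apply, LinearEquiv.coe_coe, torus_pq]
  rcases i with i | i <;> simp [coordP_pq_inr]

theorem coordQ_torus (r s : ℂˣ) (j : ℕ) (v : V n k) :
    coordQ n k j (torus n k r s v) = s * coordQ n k j v := by
  suffices h : coordQ n k j ∘ₗ (torus n k r s : V n k →ₗ[ℂ] V n k) = (s : ℂ) • coordQ n k j from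
    LinearMap.congr_fun h v
  refine (pq n k).ext fun i => ?_
  rw [LinearMap.comp_apply, LinearEquiv.coe_coe, torus_pq]
  rcases i with i | i <;> simp [coordQ_pq_inl]

theorem torus_of_coordQ_eq_zero (r s : ℂˣ) {v : V n k} (hv : ∀ j, coordQ n k j v = 0) :
    torus n k r s v = (r : ℂ) • v :=
  coord_ext (fun j => by rw [coordP_torus, map_smul, smul_eq_mul])
    (fun j => by rw [coordQ_torus, map_smul, hv, smul_zero, mul_zero])

theorem torus_of_coordP_eq_zero (r s : ℂˣ) {v : V n k} (hv : ∀ j, coordP n k j v = 0) :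
    torus n k r s v = (s : ℂ) • v :=
  coord_ext (fun j => by rw [coordP_torus, map_smul, hv, smul_zero, mul_zero])
    (fun j => by rw [coordQ_torus, map_smul, smul_eq_mul])

instance : toInfinity.NeBot := by
  refine NeBot.comap_of_range_mem inferInstance ?_
  refine mem_of_superset (Bornology.isBounded_def.mp (Bornology.isBounded_singleton (x := (0 : ℂ)))) ?_
  intro z hz
  exact ⟨Units.mk0 z hz, rfl⟩

theorem tendsto_inv_toInfinity : Tendsto (fun t : ℂˣ => ((t⁻¹ : ℂˣ) : ℂ)) toInfinity (𝓝 0) := by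
  have : Tendsto (fun t : ℂˣ => ((t : ℂ))⁻¹) toInfinity (𝓝 0) :=
    tendsto_inv₀_cobounded.comp tendsto_comap
  simpa using this

/-- After rescaling by t⁻¹ the weights on the two rows are t⁻² and 1, so only the q-part survives.
-/
theorem tendsto_smul_torus {v x y : V n k} (h : v = x + y) (hx : ∀ j, coordQ n k j x = 0)
    (hy : ∀ j, coordP n k j y = 0) :
    Tendsto (fun t : ℂˣ => ((t⁻¹ : ℂˣ) : ℂ) • torus n k t⁻¹ t v) toInfinity (𝓝 y) := by
  have h1 : ∀ t : ℂˣ, ((t⁻¹ : ℂˣ) : ℂ) • torus n k t⁻¹ t v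
      = (((t⁻¹ : ℂˣ) : ℂ) * ((t⁻¹ : ℂˣ) : ℂ)) • x + y := by
    intro t
    rw [h, map_add, torus_of_coordQ_eq_zero _ _ hx, torus_of_coordP_eq_zero _ _ hy, smul_add,
      smul_smul, smul_smul, Units.inv_mul, one_smul]
  simp_rw [h1]
  have h2 := ((tendsto_inv_toInfinity.mul tendsto_inv_toInfinity).smul_const x).add_const y
  simpa using h2

/-- A limit member contains F_i ∩ P, which the torus preserves, and the projection of F_i along P,
whose elements are limits of rescaled vectors. Conversely, under the bounds these pieces are large
enough to fill the member of the fixed flag. -/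
theorem mem_attractingSet_iff {w : RowStrictTableau n k} {F : CompleteFlag n (V n k)} :
    F ∈ w.attractingSet ↔ F ∈ springerFiber n k ∧ ∀ i ≤ n, w.BoundP F i ∧ w.BoundQ F i := by
  have hmap : ∀ (e : V n k ≃ₗ[ℂ] V n k) (i : ℕ) (v : V n k), v ∈ F.sp i → e v ∈ (F.map e).sp i :=
    fun e i v hv => Submodule.mem_map_of_mem hv
  constructor
  · rintro ⟨hY, hlim⟩
    refine ⟨hY, fun i hi => ⟨fun v hv hvQ => ?_, fun v hv => ?_⟩⟩
    · have : v ∈ w.fixedFlag.sp i := by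
        refine mem_sp_of_tendsto hlim (u := fun _ => v) (Eventually.of_forall fun t => ?_)
          tendsto_const_nhds
        have h1 := Submodule.smul_mem _ (t : ℂ) (hmap (torus n k t⁻¹ t) i v hv)
        rwa [torus_of_coordQ_eq_zero _ _ hvQ, smul_smul, Units.mul_inv, one_smul] at h1
      exact ((RowStrictTableau.mem_fixedFlag_sp hi).mp this).1
    · obtain ⟨x, y, hxy, hx, hy⟩ := exists_add_eq v
      have : y ∈ w.fixedFlag.sp i := by
        refine mem_sp_of_tendsto hlim (Eventually.of_forall fun t => ?_)
          (tendsto_smul_torus hxy hx hy)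
        exact Submodule.smul_mem _ _ (hmap (torus n k t⁻¹ t) i v hv)
      intro j hj
      rw [hxy, map_add, hx, ((RowStrictTableau.mem_fixedFlag_sp hi).mp this).2 j hj, add_zero]
  · rintro ⟨hY, hb⟩
    refine ⟨hY, tendsto_flag fun i hi v hv => ?_⟩
    obtain ⟨hs1, hs2⟩ := RowStrictTableau.saturated_of_bounds hi (hb i hi).1 (hb i hi).2
    obtain ⟨hvP, hvQ⟩ := (RowStrictTableau.mem_fixedFlag_sp hi).mp hv
    obtain ⟨x, y, hxy, hx, hy⟩ := exists_add_eq v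
    have hxF : x ∈ F.sp i := by
      refine hs1 x hx fun j hj => ?_
      have := hvP j hj
      rwa [hxy, map_add, hy, add_zero] at this
    obtain ⟨z, hz, hzv⟩ := hs2 (fun j => coordQ n k j v) hvQ
    -- The eigenvector `x` of F_i stays in the moved member, and `z` in F_i is a lift of the q-part
    -- `y`, so its rescaled translates tend to `y`.
    refine ⟨fun t => x + ((t⁻¹ : ℂˣ) : ℂ) • torus n k t⁻¹ t z, Eventually.of_forall fun t => ?_, ?_⟩
    · refine Submodule.add_mem _ ?_ (Submodule.smul_mem _ _ (hmap (torus n k t⁻¹ t) i z hz))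
      have h1 := Submodule.smul_mem _ (t : ℂ) (hmap (torus n k t⁻¹ t) i x hxF)
      rwa [torus_of_coordQ_eq_zero _ _ hx, smul_smul, Units.mul_inv, one_smul] at h1
    · have h1 : z = (z - y) + y := by abel
      have h2 := tendsto_smul_torus h1 (fun j => by
        rw [map_sub, hzv, hxy, map_add, hx, zero_add, sub_self]) hy
      rw [hxy]
      exact h2.const_add x

/-! ### Cups -/

namespace CupDiagram

variable (C : CupDiagram n)

theorem lt_partner_of_mem {i j : Fin n} (h1 : i < j) (h2 : j < C.partner i) :
    i < C.partner j ∧ C.partner j < C.partner i :=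
  (C.crossingless i j h1 h2).2

theorem partner_partner (i : Fin n) : C.partner (C.partner i) = i := C.involutive i

/-- The interval of the points of a cup is stable under exchanging ends. -/
theorem partner_mem_Icc {a j : Fin n} (h1 : a ≤ j) (h2 : j ≤ C.partner a) :
    a ≤ C.partner j ∧ C.partner j ≤ C.partner a := by
  rcases h1.eq_or_lt with rfl | h1
  · exact ⟨h2, le_rfl⟩
  · rcases h2.eq_or_lt with rfl | h2
    · rw [C.partner_partner]; exact ⟨le_rfl, h1.le⟩
    · have := C.lt_partner_of_mem h1 h2
      exact ⟨this.1.le, this.2.le⟩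

theorem partner_ne_of_mem {a j : Fin n} (h1 : a ≤ j) (h2 : j ≤ C.partner a)
    (ha : a < C.partner a) : C.partner j ≠ j := by
  rcases h1.eq_or_lt with rfl | h1
  · exact ha.ne'
  · rcases h2.eq_or_lt with rfl | h2
    · rw [C.partner_partner]; exact ha.ne
    · exact (C.crossingless a j h1 h2).1

end CupDiagram

namespace RowStrictTableau

variable {w : RowStrictTableau n k} {D : CupDiagram n}

theorem Orients.partner_mem_vee_iff (h : w.Orients D) {j : Fin n} (hj : D.partner j ≠ j) :
    D.partner j ∈ w.vee ↔ j ∈ w.wedge := by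
  rcases lt_or_gt_of_ne hj with hlt | hlt
  · have hm : D.partner j ∈ D.leftEnds := by
      change D.partner j < D.partner (D.partner j); rwa [D.partner_partner]
    have := h _ hm
    rw [D.partner_partner] at this
    rcases this with ⟨h1, h2⟩ | ⟨h1, h2⟩
    · exact ⟨fun _ => h2, fun _ => h1⟩
    · exact ⟨fun h3 => absurd h3 (notMem_vee_of_mem_wedge h1),
        fun h3 => absurd h2 (notMem_vee_of_mem_wedge h3)⟩
  · rcases h j hlt with ⟨h1, h2⟩ | ⟨h1, h2⟩
    · exact ⟨fun h3 => absurd h3 (notMem_vee_of_mem_wedge h2),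
        fun h3 => absurd h1 (notMem_vee_of_mem_wedge h3)⟩
    · exact ⟨fun _ => h1, fun _ => h2⟩

theorem Orients.partner_mem_wedge_iff (h : w.Orients D) {j : Fin n} (hj : D.partner j ≠ j) :
    D.partner j ∈ w.wedge ↔ j ∈ w.vee := by
  rw [← notMem_vee_iff, h.partner_mem_vee_iff hj, notMem_wedge_iff]

/-- Exchanging the ends of cups preserves the interval of points from `a` to its partner and swaps
the two marks. -/
theorem Orients.ncard_cup (h : w.Orients D) {a : Fin n} (ha : a < D.partner a) :
    {j : Fin n | (a : ℕ) ≤ j ∧ (j : ℕ) < D.partner a + 1 ∧ j ∈ w.wedge}.ncard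
      = {j : Fin n | (a : ℕ) ≤ j ∧ (j : ℕ) < D.partner a + 1 ∧ j ∈ w.vee}.ncard := by
  rw [← Set.ncard_image_of_injective _ D.involutive.injective]
  congr 1
  ext j
  simp only [Set.mem_image, Set.mem_ofPred_eq]
  constructor
  · rintro ⟨i, ⟨h1, h2, h3⟩, rfl⟩
    have h2' : i ≤ D.partner a := by omega
    have := D.partner_mem_Icc (a := a) (j := i) h1 h2'
    exact ⟨this.1, by omega,
      (h.partner_mem_vee_iff (D.partner_ne_of_mem h1 h2' ha)).mpr h3⟩
  · rintro ⟨h1, h2, h3⟩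
    have h2' : j ≤ D.partner a := by omega
    have := D.partner_mem_Icc (a := a) (j := j) h1 h2'
    exact ⟨D.partner j, ⟨this.1, by omega,
      (h.partner_mem_wedge_iff (D.partner_ne_of_mem h1 h2' ha)).mpr h3⟩, D.partner_partner j⟩

theorem Orients.count_cup (h : w.Orients D) {a : Fin n} (ha : a < D.partner a) :
    ∃ l : ℕ, 0 < l ∧ (D.partner a : ℕ) + 1 = a + 2 * l ∧
      w.tN (D.partner a + 1) = w.tN a + l ∧ w.bN (D.partner a + 1) = w.bN a + l := by
  have h0 : (a : ℕ) < D.partner a := ha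
  have h1 := countBelow_add (A := w.wedge) (x := a) (y := D.partner a + 1) (by omega)
  have h2 := countBelow_add (A := w.vee) (x := a) (y := D.partner a + 1) (by omega)
  rw [h.ncard_cup ha] at h1
  have h3 := w.tN_add_bN (i := a) (by omega)
  have h4 := w.tN_add_bN (i := D.partner a + 1) (by omega)
  unfold tN bN at *
  exact ⟨_, by omega, by omega, h1, h2⟩

/-- The condition which a cup with left end `a` imposes on the flags of a component. -/
def _root_.TwoRowSpringer.CupDiagram.CupRel {k : ℕ} (D : CupDiagram n)
    (F : CompleteFlag n (V n k)) (a : Fin n) : Prop :=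
  ∀ l : ℕ, (D.partner a : ℕ) + 1 = a + 2 * l → ∀ v ∈ F.sp (D.partner a + 1), (N n k ^ l) v ∈ F.sp a

/-- Read the interval from the right: a cup inside it costs N^l, where l is its number of ∧'s, and
any other point is a ∧ by `h2` and costs one N by the Springer condition. The exponent is thus the
number of ∧'s in the interval. -/
theorem Orients.N_pow_mem_of_cupRel (h : w.Orients D) {F : CompleteFlag n (V n k)}
    (hF : F ∈ springerFiber n k) {x y : ℕ} (hxy : x ≤ y) (hy : y ≤ n)
    (h1 : ∀ c : Fin n, x ≤ c → c < D.partner c → (D.partner c : ℕ) < y → D.CupRel F c)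
    (h2 : ∀ j : Fin n, x ≤ j → (j : ℕ) < y → ((D.partner j : ℕ) < x ∨ D.partner j = j) →
      j ∈ w.wedge)
    (h3 : ∀ j : Fin n, x ≤ j → (j : ℕ) < y → (D.partner j : ℕ) < y) :
    ∀ v ∈ F.sp y, (N n k ^ (w.tN y - w.tN x)) v ∈ F.sp x := by
  have hF' := (mem_springerFiber_iff w.card_le).mp hF
  induction y using Nat.strong_induction_on with
  | _ y ih =>
  rcases hxy.eq_or_lt with rfl | hlt
  · intro v hv; simpa using hv
  obtain ⟨y, rfl⟩ : ∃ z, y = z + 1 := ⟨y - 1, by omega⟩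
  set j : Fin n := ⟨y, by omega⟩ with hj
  have hjy : (j : ℕ) = y := rfl
  intro v hv
  have hpj := h3 j (by omega) (by omega)
  by_cases hc : (D.partner j : ℕ) < x ∨ D.partner j = j
  · have hjw := h2 j (by omega) (by omega) hc
    have htN : w.tN (y + 1) = w.tN y + 1 := w.tN_succ_of_mem_wedge hjw
    have hmono : w.tN x ≤ w.tN y := countBelow_mono _ (by omega)
    have := ih y (by omega) (by omega) (by omega) (fun c h4 h5 h6 => h1 c h4 h5 (by omega))
      (fun i h4 h5 => h2 i h4 (by omega)) (fun i h4 h5 => ?_) _ (hF' y v hv)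
    · rw [show w.tN (y + 1) - w.tN x = (w.tN y - w.tN x) + 1 by omega, pow_succ]
      exact this
    · have := h3 i h4 (by omega)
      by_contra h6
      have h7 : D.partner i = j := Fin.ext (by omega)
      have h8 : D.partner j = i := by rw [← h7, D.partner_partner]
      rcases hc with hc | hc
      · rw [h8] at hc; omega
      · rw [h8] at hc; rw [hc] at h5; omega
  · push Not at hc
    have hne : (D.partner j : ℕ) ≠ j := fun h => hc.2 (Fin.ext h)
    set c := D.partner j with hcdef
    have hcj : D.partner c = j := D.partner_partner j
    have hclt : c < D.partner c := by rw [hcj]; exact Fin.lt_def.mpr (by omega)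
    obtain ⟨l, -, hl, hlt', -⟩ := h.count_cup hclt
    have hrel := h1 c hc.1 hclt (by rw [hcj]; omega) l hl v (by rw [hcj]; exact hv)
    have hmono : w.tN x ≤ w.tN c := countBelow_mono _ hc.1
    rw [hcj, hjy] at hlt'
    have := ih c (by omega) hc.1 (by omega) (fun c h4 h5 h6 => h1 c h4 h5 (by omega))
      (fun i h4 h5 => h2 i h4 (by omega)) (fun i h4 h5 => ?_) _ hrel
    · rw [show w.tN (y + 1) - w.tN x = (w.tN c - w.tN x) + l by omega, pow_add]
      exact this
    · have h6 := h3 i h4 (by omega)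
      by_contra h7
      have h8 : D.partner i ≠ c := fun h8 => by
        have := D.involutive.injective (h8.trans hcdef)
        rw [this] at h5; omega
      have h9 : D.partner i ≠ j := fun h9 => by
        rw [← h9, D.partner_partner] at hcdef
        rw [hcdef] at h5; omega
      have h8' : (D.partner i : ℕ) ≠ c := fun h => h8 (Fin.ext h)
      have h9' : (D.partner i : ℕ) ≠ j := fun h => h9 (Fin.ext h)
      have := D.lt_partner_of_mem (i := c) (j := D.partner i) (Fin.lt_def.mpr (by omega))
        (by rw [hcj]; exact Fin.lt_def.mpr (by omega))
      rw [D.partner_partner] at this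
      have := this.1
      omega

end RowStrictTableau

namespace RowStrictTableau

variable {w : RowStrictTableau n k} {D : CupDiagram n}

/-- A cup diagram with the properties of the completed cup diagram of `w`. -/
structure Adapted (w : RowStrictTableau n k) (D : CupDiagram n) : Prop where
  orients : w.Orients D
  ray : ∀ i, D.partner i = i → i ∈ w.wedge
  inner : ∀ a i, a ∈ w.vee → a < i → i < D.partner a → i < D.partner i → i ∈ w.vee
  sep : ∀ i j, i ∈ w.wedge → i ≤ D.partner i → j ∈ w.vee → D.partner j ≤ j → i < j

/-- The points strictly below the cup are matched among themselves and cost N^(l-1); the left end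
costs one more N. What remains for the relation of the cup is the step at its right end. -/
theorem Orients.N_pow_mem_of_inner (h : w.Orients D) {F : CompleteFlag n (V n k)}
    (hF : F ∈ springerFiber n k) {a : Fin n} (ha : a ∈ w.vee) (hlt : a < D.partner a)
    (hc : ∀ c, a < c → c < D.partner c → D.partner c < D.partner a → D.CupRel F c)
    {l : ℕ} (hl : (D.partner a : ℕ) + 1 = a + 2 * l) :
    ∀ v ∈ F.sp (D.partner a), (N n k ^ l) v ∈ F.sp a := by
  intro v hv
  have h0 : (a : ℕ) < D.partner a := hlt
  have hb : D.partner a ∈ w.wedge := (h.partner_mem_wedge_iff hlt.ne').mpr ha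
  have h1 := h.N_pow_mem_of_cupRel hF (x := a + 1) (y := D.partner a) (by omega) (by omega)
    (fun c h1 h2 h3 => hc c (Fin.lt_def.mpr (by omega)) h2 h3)
    (fun j h1 h2 h3 => ?_) (fun j h1 h2 => ?_) v hv
  · obtain ⟨l', -, hl', ht, -⟩ := h.count_cup hlt
    obtain rfl : l = l' := by omega
    rw [tN_succ_of_mem_wedge hb] at ht
    rw [tN_succ_of_mem_vee ha] at h1
    have h2 := (mem_springerFiber_iff w.card_le).mp hF a _ h1
    rw [show l = (w.tN (D.partner a) - w.tN a) + 1 by omega, pow_succ']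
    exact h2
  · have h4 := D.crossingless a j (Fin.lt_def.mpr (by omega)) (Fin.lt_def.mpr h2)
    rcases h3 with h3 | h3
    · have := h4.2.1; omega
    · exact absurd h3 h4.1
  · exact (D.crossingless a j (Fin.lt_def.mpr (by omega)) (Fin.lt_def.mpr h2)).2.2

theorem pq_mem_of_attracting {F : CompleteFlag n (V n k)} (hF : F ∈ w.attractingSet) {i : ℕ}
    (hi : i ≤ n) {j : Fin (n - k)} : pq n k (Sum.inl j) ∈ F.sp i ↔ (j : ℕ) < w.tN i := by
  obtain ⟨hY, hb⟩ := mem_attractingSet_iff.mp hF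
  constructor
  · intro h
    by_contra hj
    have := (hb i hi).1 _ h (fun _ => coordQ_pq_inl _ _) j (by omega)
    simp [coordP_pq_inl] at this
  · intro h
    refine (saturated_of_bounds hi (hb i hi).1 (hb i hi).2).1 _ (fun _ => coordQ_pq_inl _ _) ?_
    intro i hi
    rw [coordP_pq_inl, if_neg (by omega)]

/-- At a ∧ the intersection of the flag with P grows by the next basis vector, which therefore spans
the whole step. -/
theorem exists_sp_succ_eq_sup {F : CompleteFlag n (V n k)} (hF : F ∈ w.attractingSet) {i : Fin n}
    (hi : i ∈ w.wedge) : ∃ h : w.tN i < n - k,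
      F.sp (i + 1) = F.sp i ⊔ Submodule.span ℂ {pq n k (Sum.inl ⟨w.tN i, h⟩)} := by
  have h1 := w.tN_succ_of_mem_wedge hi
  have h2 := w.tN_le (i + 1)
  refine ⟨by omega, F.sp_succ_eq_sup i.isLt ?_ ?_⟩
  · rw [pq_mem_of_attracting hF (by omega)]; simp; omega
  · rw [pq_mem_of_attracting hF (by omega)]; simp

/-- Induction on the width: the cups below are counter-clockwise by `inner`. The right end adjoins
the last p allowed there, and since the cup contains l ∧'s, N^l shifts it below the bound t_a, hence
into F_a. -/
theorem Adapted.cupRel_of_mem_vee (h : w.Adapted D) {F : CompleteFlag n (V n k)}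
    (hF : F ∈ w.attractingSet) {a : Fin n} (ha : a ∈ w.vee) (hlt : a < D.partner a) :
    D.CupRel F a := by
  induction hm : (D.partner a : ℕ) - a using Nat.strong_induction_on generalizing a with
  | _ m ih =>
  subst hm
  have h0 : (a : ℕ) < D.partner a := hlt
  intro l hl v hv
  have hb : D.partner a ∈ w.wedge := (h.orients.partner_mem_wedge_iff hlt.ne').mpr ha
  have h1 := h.orients.N_pow_mem_of_inner hF.1 ha hlt (fun c h1 h2 h3 =>
    ih _ (by have : (c : ℕ) < D.partner c := h2; omega) (h.inner a c ha h1 (h2.trans h3) h2) h2 rfl) hl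
  obtain ⟨ht, hs⟩ := exists_sp_succ_eq_sup hF hb
  rw [hs, Submodule.mem_sup] at hv
  obtain ⟨y, hy, z, hz, rfl⟩ := hv
  obtain ⟨c, rfl⟩ := Submodule.mem_span_singleton.mp hz
  rw [map_add, map_smul]
  refine Submodule.add_mem _ (h1 y hy) (Submodule.smul_mem _ _ ?_)
  obtain ⟨-, hbd⟩ := mem_attractingSet_iff.mp hF
  refine (saturated_of_bounds (by omega) (hbd a (by omega)).1 (hbd a (by omega)).2).1 _
    (fun j => by rw [coordQ_N_pow, coordQ_pq_inl]) (fun j hj => ?_)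
  obtain ⟨l', -, hl', ht, -⟩ := h.orients.count_cup hlt
  rw [tN_succ_of_mem_wedge hb] at ht
  rw [coordP_N_pow, coordP_pq_inl, if_neg]
  simp only
  omega

/-- N^l lowers dimensions by at most 2l, which is exactly the difference of the two dimensions. -/
theorem map_eq_of_cupRel {F : CompleteFlag n (V n k)} {a : Fin n}
    (hr : D.CupRel F a) {l : ℕ} (hl : (D.partner a : ℕ) + 1 = a + 2 * l) :
    F.sp a = (F.sp (D.partner a + 1)).map (N n k ^ l) := by
  symm
  refine Submodule.eq_of_le_of_finrank_le ?_ ?_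
  · rintro _ ⟨v, hv, rfl⟩
    exact hr l hl v hv
  · have := finrank_le_finrank_map_N_pow l (F.sp (D.partner a + 1))
    rw [F.finrank_sp (by omega)] at this
    rw [F.finrank_sp (by omega)]
    omega

/-- No cup with left end marked `∨` passes over the gap preceding the point `x`. -/
def Outer (w : RowStrictTableau n k) (D : CupDiagram n) (x : ℕ) : Prop :=
  ∀ c ∈ w.vee, (c : ℕ) < x → (D.partner c : ℕ) < x

theorem Outer.of_cup {a : Fin n} (ha : a < D.partner a) (ho : w.Outer D (D.partner a + 1)) :
    w.Outer D a := by
  have h0 : (a : ℕ) < D.partner a := ha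
  intro c hc hca
  have h1 := ho c hc (by omega)
  by_contra h2
  rcases (show (a : ℕ) ≤ D.partner c by omega).eq_or_lt with h3 | h3
  · rw [Fin.ext h3, D.partner_partner] at h0
    omega
  · have h4 : (D.partner c : ℕ) ≠ D.partner a := fun h4 => by
      have := D.involutive.injective (Fin.ext h4)
      rw [this] at hca; omega
    have := D.lt_partner_of_mem (i := a) (j := D.partner c) h3 (Fin.lt_def.mpr (by omega))
    rw [D.partner_partner] at this
    exact absurd this.1 (not_lt.mpr hca.le)

theorem Outer.cup_succ {a : Fin n} (ha : a < D.partner a) (ho : w.Outer D a) :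
    w.Outer D (D.partner a + 1) := by
  have h0 : (a : ℕ) < D.partner a := ha
  intro c hc hca
  by_contra h1
  rcases lt_or_ge (c : ℕ) a with h2 | h2
  · have := ho c hc h2; omega
  · have := (D.partner_mem_Icc (a := a) (j := c) h2 (Fin.le_def.mpr (by omega))).2
    have : (D.partner c : ℕ) ≤ D.partner a := this
    omega

theorem Adapted.outer_of_mem_wedge (h : w.Adapted D) {a : Fin n} (ha : a ∈ w.wedge)
    (hle : a ≤ D.partner a) : w.Outer D a ∧ w.Outer D (a + 1) := by
  have key : ∀ c ∈ w.vee, (c : ℕ) < a → (D.partner c : ℕ) < a := by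
    intro c hc hca
    by_contra h1
    rcases (show (a : ℕ) ≤ D.partner c by omega).eq_or_lt with h2 | h2
    · rw [Fin.ext h2, D.partner_partner, ← Fin.ext h2] at hle
      exact absurd hle (not_le.mpr hca)
    · rcases hle.eq_or_lt with h3 | h3
      · exact (D.crossingless c a hca h2).1 h3.symm
      · exact notMem_vee_of_mem_wedge ha (h.inner c a hc hca h2 h3)
  refine ⟨key, fun c hc hca => ?_⟩
  have : (c : ℕ) ≠ a := fun h => notMem_vee_of_mem_wedge ha (by rwa [Fin.ext h] at hc)
  have := key c hc (by omega)
  omega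

/-- Left of a ∧ that is a left end or a ray, nothing is free outside the counter-clockwise cups.
Crossing such a cup replaces a fixed member by its preimage under N^l, again fixed because both
counts grow by l; crossing any other ∧ adjoins a basis vector. -/
theorem Adapted.sp_eq_fixedFlag_of_outer (h : w.Adapted D) {F : CompleteFlag n (V n k)}
    (hF : F ∈ w.attractingSet) {a : Fin n} (ha : a ∈ w.wedge) (hle : a ≤ D.partner a) {x : ℕ}
    (hx : x ≤ a + 1) (ho : w.Outer D x) : F.sp x = w.fixedFlag.sp x := by
  induction x using Nat.strong_induction_on with
  | _ x ih =>
  refine F.sp_eq_of_le (by omega) (by rw [w.fixedFlag.finrank_sp (by omega)]) fun v hv => ?_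
  rw [mem_fixedFlag_sp (by omega)]
  rcases Nat.eq_zero_or_pos x with rfl | hpos
  · rw [F.sp_zero, Submodule.mem_bot] at hv
    simp [hv]
  obtain ⟨y, rfl⟩ : ∃ z, x = z + 1 := ⟨x - 1, by omega⟩
  set j : Fin n := ⟨y, by omega⟩ with hj
  have hjy : (j : ℕ) = y := rfl
  rw [← hjy] at hv ho ⊢
  rcases w.mem_wedge_or_mem_vee j with hjw | hjv
  · by_cases hjp : D.partner j < j
    · set c := D.partner j with hc
      have hcj : D.partner c = j := D.partner_partner j
      have hlt : c < D.partner c := by rwa [hcj]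
      have hcv : c ∈ w.vee := (h.orients.partner_mem_vee_iff hjp.ne).mpr hjw
      obtain ⟨l, -, hl, ht, hb⟩ := h.orients.count_cup hlt
      have hlt' : (c : ℕ) < j := hjp
      have h1 := h.cupRel_of_mem_vee hF hcv hlt l hl v (by rwa [hcj])
      rw [hcj] at ht hb
      rw [ih c (by omega) (by omega) (Outer.of_cup hlt (by rwa [hcj])),
        mem_fixedFlag_sp (by omega)] at h1
      constructor
      · intro i hi
        have := h1.1 (i - l) (by omega)
        rwa [coordP_N_pow, Nat.sub_add_cancel (by omega)] at this
      · intro i hi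
        have := h1.2 (i - l) (by omega)
        rwa [coordQ_N_pow, Nat.sub_add_cancel (by omega)] at this
    · obtain ⟨ht, hs⟩ := exists_sp_succ_eq_sup hF hjw
      rw [hs, Submodule.mem_sup] at hv
      obtain ⟨u, hu, z, hz, rfl⟩ := hv
      obtain ⟨c, rfl⟩ := Submodule.mem_span_singleton.mp hz
      rw [ih j (by omega) (by omega) (h.outer_of_mem_wedge hjw (not_lt.mp hjp)).1,
        mem_fixedFlag_sp (by omega)] at hu
      rw [tN_succ_of_mem_wedge hjw, bN_succ_of_mem_wedge hjw]
      constructor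
      · intro i hi
        rw [map_add, hu.1 i (by omega), map_smul, coordP_pq_inl, if_neg (by simp only; omega)]
        simp
      · intro i hi
        rw [map_add, hu.2 i (by omega), map_smul, coordQ_pq_inl]
        simp
  -- A ∨ cannot occur here: as a left end its cup would pass over the gap, against `ho`; otherwise
  -- `sep` puts it to the right of `a`.
  · by_cases hjp : j < D.partner j
    · have h1 := ho j hjv (by omega)
      have h2 : (j : ℕ) < D.partner j := hjp
      omega
    · have h1 : (a : ℕ) < j := h.sep a j ha hle hjv (not_lt.mp hjp)
      omega

/-- Induction from the right end of the line. Beyond `b` the next point cannot be ∧: `sep` excludes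
left ends and rays, and `ho` excludes right ends. At a ∨ with a cup, F_a = N^l F_{b+1} raises the
exponent by l; at another ∨ the exponent does not change. -/
theorem Adapted.sp_le_range_of_outer (h : w.Adapted D) {F : CompleteFlag n (V n k)}
    (hF : F ∈ w.attractingSet) {b : Fin n} (hb : b ∈ w.vee) (hle : D.partner b ≤ b) {x : ℕ}
    (hx : b < x) (hxn : x ≤ n) (ho : w.Outer D x) :
    F.sp x ≤ LinearMap.range (N n k ^ (n - k - w.tN x)) := by
  induction hm : n - x using Nat.strong_induction_on generalizing x with
  | _ m ih =>
  subst hm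
  rcases hxn.eq_or_lt with rfl | hlt
  · rw [tN_last, Nat.sub_self, pow_zero, Module.End.one_eq_id, LinearMap.range_id]
    exact le_top
  set j : Fin n := ⟨x, by omega⟩ with hj
  have hjx : (j : ℕ) = x := rfl
  rw [← hjx] at ho ⊢
  rcases w.mem_wedge_or_mem_vee j with hjw | hjv
  · exfalso
    by_cases hjp : D.partner j < j
    · have := ho _ ((h.orients.partner_mem_vee_iff hjp.ne).mpr hjw) hjp
      rw [D.partner_partner] at this
      omega
    · have : (j : ℕ) < b := h.sep j b hjw (not_lt.mp hjp) hb hle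
      omega
  · by_cases hjp : j < D.partner j
    · have h0 : (j : ℕ) < D.partner j := hjp
      obtain ⟨l, -, hl, ht, -⟩ := h.orients.count_cup hjp
      have := ih _ (by omega) (x := D.partner j + 1) (by omega) (by omega) (ho.cup_succ hjp) rfl
      rw [map_eq_of_cupRel (h.cupRel_of_mem_vee hF hjv hjp) hl]
      rintro _ ⟨v, hv, rfl⟩
      obtain ⟨u, rfl⟩ := this hv
      refine ⟨u, ?_⟩
      rw [N_pow_N_pow]
      have := w.tN_le (D.partner j + 1)
      congr 2
      omega
    · have h1 := ih _ (by omega) (x := j + 1) (by omega) (by omega) (fun c hc hcj => ?_) rfl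
      · rw [tN_succ_of_mem_vee hjv] at h1
        exact (F.sp_mono (Nat.le_succ _)).trans h1
      · rcases (show (c : ℕ) ≤ j by omega).eq_or_lt with h2 | h2
        · have : D.partner c ≤ j := by rw [Fin.ext h2]; exact not_lt.mp hjp
          omega
        · have := ho c hc h2; omega

/-- For a clockwise cup F_a is the fixed member, so only coordinates must be bounded: the
p-coordinates by the inclusion of F_{b+1} in the image of a power of N, the q-coordinates by
`BoundQ`. -/
theorem Adapted.cupRel_of_attracting (h : w.Adapted D) {F : CompleteFlag n (V n k)}
    (hF : F ∈ w.attractingSet) {a : Fin n} (hlt : a < D.partner a) :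
    D.CupRel F a := by
  rcases w.mem_wedge_or_mem_vee a with ha | ha
  · have hb : D.partner a ∈ w.vee := (h.orients.partner_mem_vee_iff hlt.ne').mpr ha
    have ho := h.outer_of_mem_wedge ha hlt.le
    obtain ⟨l, -, hl, ht, hbN⟩ := h.orients.count_cup hlt
    intro l' hl' v hv
    obtain rfl : l = l' := by omega
    rw [h.sp_eq_fixedFlag_of_outer hF ha hlt.le (Nat.le_succ _) ho.1, mem_fixedFlag_sp (by omega)]
    constructor
    · intro j hj
      have h1 := h.sp_le_range_of_outer hF hb (by rw [D.partner_partner]; exact hlt.le)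
        (x := D.partner a + 1) (by omega) (by omega) (ho.1.cup_succ hlt) hv
      obtain ⟨u, rfl⟩ := h1
      rw [coordP_N_pow, coordP_N_pow, coordP_of_le]
      have := w.tN_le (D.partner a + 1)
      omega
    · intro j hj
      rw [coordQ_N_pow]
      exact ((mem_attractingSet_iff.mp hF).2 _ (by omega)).2 v hv _ (by omega)
  · exact h.cupRel_of_mem_vee hF ha hlt

/-- The flags of the Springer fiber satisfying the relations of all cups of `D`. -/
def _root_.TwoRowSpringer.CupDiagram.cupVariety (D : CupDiagram n) (k : ℕ) :
    Set (CompleteFlag n (V n k)) :=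
  {F | F ∈ springerFiber n k ∧ ∀ a, a < D.partner a → D.CupRel F a}

/-- The flags satisfying the relations of all cups of `D` and agreeing with the fixed flag of `w`
at the left ends of the clockwise cups. -/
def orientedCupVariety (w : RowStrictTableau n k) (D : CupDiagram n) :
    Set (CompleteFlag n (V n k)) :=
  {F | F ∈ D.cupVariety k ∧
    ∀ a, a ∈ w.wedge → a < D.partner a → F.sp (a + 1) = w.fixedFlag.sp (a + 1)}

theorem Adapted.attractingSet_subset (h : w.Adapted D) :
    w.attractingSet ⊆ w.orientedCupVariety D := fun _ hF =>
  ⟨⟨hF.1, fun _ hlt => h.cupRel_of_attracting hF hlt⟩, fun _ ha hlt =>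
    h.sp_eq_fixedFlag_of_outer hF ha hlt.le le_rfl (h.outer_of_mem_wedge ha hlt.le).2⟩

/-! ### Closedness of the cup conditions. -/

theorem isClosed_springerFiber (hk : k ≤ n) : IsClosed (springerFiber n k) := by
  have : springerFiber n k = ⋂ i : ℕ, {F | ∀ v ∈ F.sp (i + 1), N n k v ∈ F.sp i} := by
    ext F
    rw [mem_springerFiber_iff hk, Set.mem_iInter]
    rfl
  rw [this]
  exact isClosed_iInter fun i => isClosed_setOf_map_sp_le _ _ _

theorem isClosed_cupVariety (hk : k ≤ n) : IsClosed (D.cupVariety k) := by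
  have : D.cupVariety k = springerFiber n k ∩ ⋂ (a : Fin n) (_ : a < D.partner a) (l : ℕ)
      (_ : (D.partner a : ℕ) + 1 = a + 2 * l),
      {F | ∀ v ∈ F.sp (D.partner a + 1), (N n k ^ l) v ∈ F.sp a} := by
    ext F
    simp only [CupDiagram.cupVariety, CupDiagram.CupRel, Set.mem_inter_iff, Set.mem_iInter,
      Set.mem_ofPred_eq]
  rw [this]
  exact (isClosed_springerFiber hk).inter (isClosed_iInter fun a => isClosed_iInter fun _ =>
    isClosed_iInter fun l => isClosed_iInter fun _ => isClosed_setOf_map_sp_le _ _ _)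

theorem isClosed_orientedCupVariety : IsClosed (w.orientedCupVariety D) := by
  have : w.orientedCupVariety D = D.cupVariety k ∩ ⋂ (a : Fin n) (_ : a ∈ w.wedge)
      (_ : a < D.partner a), {F | F.sp (a + 1) ≤ w.fixedFlag.sp (a + 1)} := by
    ext F
    simp only [orientedCupVariety, Set.mem_inter_iff, Set.mem_iInter, Set.mem_ofPred_eq]
    refine and_congr_right fun _ => forall_congr' fun a => forall_congr' fun _ =>
      forall_congr' fun _ => ⟨fun h => h.le, fun h => ?_⟩
    exact F.sp_eq_of_le (by omega) (by rw [w.fixedFlag.finrank_sp (by omega)]) h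
  rw [this]
  exact (isClosed_cupVariety w.card_le).inter (isClosed_iInter fun a => isClosed_iInter fun _ =>
    isClosed_iInter fun _ => isClosed_setOf_sp_le _ _)

end RowStrictTableau

/-! ### Perturbing a flag inside a cup -/

section Perturbation

variable {W : Type*} [AddCommGroup W] [Module ℂ W]

theorem pow_mem_of_stable {f : W →ₗ[ℂ] W} {U : Submodule ℂ W} (hU : ∀ u ∈ U, f u ∈ U) (m : ℕ) :
    ∀ u ∈ U, (f ^ m) u ∈ U := by
  induction m with
  | zero => intro u hu; simpa using hu
  | succ m ih => intro u hu; rw [pow_succ', Module.End.mul_apply]; exact hU _ (ih u hu)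

theorem pow_mem_of_le {f : W →ₗ[ℂ] W} {U : Submodule ℂ W} (hU : ∀ u ∈ U, f u ∈ U) {i j : ℕ}
    (hij : i ≤ j) {v : W} (hv : (f ^ i) v ∈ U) : (f ^ j) v ∈ U := by
  obtain ⟨m, rfl⟩ := Nat.exists_eq_add_of_le' hij
  rw [pow_add, Module.End.mul_apply]
  exact pow_mem_of_stable hU m _ hv

/-- In a relation x = u + ∑ c_j f^j Z, apply f^(l-1-j) for the first nonzero c_j: later terms fall
into U, the left side stays in A, and c_j f^(l-1) Z would lie in A. So all c_j vanish, and x would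
lie in U. -/
theorem notMem_sup_span_pow {f : W →ₗ[ℂ] W} {U A : Submodule ℂ W} {l : ℕ} {x Z : W}
    (hU : ∀ u ∈ U, f u ∈ U) (hUA : U ≤ A) (hx : x ∉ U) (hxA : x ∈ A) (hfx : f x ∈ U)
    (hl : 0 < l) (hZl : (f ^ l) Z ∈ U) (hZ : (f ^ (l - 1)) Z ∉ A) :
    x ∉ U ⊔ Submodule.span ℂ (Set.range fun j : Fin l => (f ^ (j : ℕ)) Z) := by
  intro h
  obtain ⟨u, hu, z, hz, hxuz⟩ := Submodule.mem_sup.mp h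
  obtain ⟨c, rfl⟩ := (Submodule.mem_span_range_iff_exists_fun ℂ).mp hz
  have hterm : ∀ j : Fin l, (f ^ (l - 1 - (j : ℕ))) (c j • (f ^ (j : ℕ)) Z)
      = c j • (f ^ (l - 1)) Z := by
    intro j
    rw [map_smul, ← Module.End.mul_apply, ← pow_add]
    congr 3
    omega
  have hc : ∀ j : Fin l, c j = 0 := by
    intro j
    induction hm : (j : ℕ) using Nat.strong_induction_on generalizing j with
    | _ m ih =>
    subst hm
    by_contra hne
    have h1 : (f ^ (l - 1 - (j : ℕ))) (∑ i, c i • (f ^ (i : ℕ)) Z) ∈ A := by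
      rw [show ∑ i, c i • (f ^ (i : ℕ)) Z = x - u by rw [← hxuz]; abel, map_sub]
      refine A.sub_mem ?_ (hUA (pow_mem_of_stable hU _ _ hu))
      rcases Nat.eq_zero_or_pos (l - 1 - (j : ℕ)) with h0 | h0
      · rw [h0]; simpa using hxA
      · exact hUA (pow_mem_of_le hU (i := 1) h0 (by simpa using hfx))
    rw [map_sum, ← Finset.add_sum_erase _ _ (Finset.mem_univ j), hterm] at h1
    have h2 : ∑ i ∈ Finset.univ.erase j, (f ^ (l - 1 - (j : ℕ))) (c i • (f ^ (i : ℕ)) Z) ∈ A := by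
      refine A.sum_mem fun i hi => ?_
      have hij : (i : ℕ) ≠ j := fun h => (Finset.mem_erase.mp hi).1 (Fin.ext h)
      rcases lt_or_gt_of_ne hij with h3 | h3
      · rw [ih i h3 i rfl]; simp
      · rw [map_smul, ← Module.End.mul_apply, ← pow_add]
        exact A.smul_mem _ (hUA (pow_mem_of_le hU (by omega) hZl))
    exact hZ ((A.smul_mem_iff hne).mp ((A.add_mem_iff_left h2).mp h1))
  apply hx
  rw [← hxuz]
  simpa [hc] using hu

/-- Modulo U, E is a module over ℂ[f]/(f^l), and a functional g yields the module map v ↦ ∑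
g(f^(l-1-j) v) f^j Z. Taking g zero on U and on all f^j Z makes φ square to zero; g(x) ≠ 0 allows
normalizing φ(x), where only the term j = l - 1 survives because f x lies in U. -/
theorem exists_perturbation {f : W →ₗ[ℂ] W} {U A E : Submodule ℂ W} {l : ℕ} {x Z : W}
    (hU : ∀ u ∈ U, f u ∈ U) (hE : ∀ v ∈ E, f v ∈ E) (hUA : U ≤ A) (hx : x ∉ U) (hxA : x ∈ A)
    (hfx : f x ∈ U) (hl : 0 < l) (hEl : ∀ v ∈ E, (f ^ l) v ∈ U) (hZE : Z ∈ E)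
    (hZ : (f ^ (l - 1)) Z ∉ A) : ∃ φ : W →ₗ[ℂ] W, (∀ u ∈ U, φ u = 0) ∧ (∀ v, φ v ∈ E) ∧
      (∀ v, φ (φ v) = 0) ∧ (∀ v ∈ E, φ (f v) - f (φ v) ∈ U) ∧ φ x = (f ^ (l - 1)) Z := by
  have hns := notMem_sup_span_pow hU hUA hx hxA hfx hl (hEl Z hZE) hZ
  obtain ⟨g, hgx, hg⟩ := Submodule.exists_le_ker_of_notMem hns
  have hgU : ∀ u ∈ U, g u = 0 := fun u hu => hg (Submodule.mem_sup_left hu)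
  have hgZ : ∀ j, g ((f ^ j) Z) = 0 := by
    intro j
    rcases lt_or_ge j l with h | h
    · exact hg (Submodule.mem_sup_right (Submodule.subset_span ⟨⟨j, h⟩, rfl⟩))
    · exact hgU _ (pow_mem_of_le hU h (hEl Z hZE))
  obtain ⟨m, rfl⟩ : ∃ m, l = m + 1 := ⟨l - 1, by omega⟩
  rw [Nat.add_sub_cancel] at hZ ⊢
  let φ : W →ₗ[ℂ] W := (g x)⁻¹ • ∑ j ∈ Finset.range (m + 1),
    (g ∘ₗ (f ^ (m - j))).smulRight ((f ^ j) Z)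
  have hφ : ∀ v, φ v = (g x)⁻¹ • ∑ j ∈ Finset.range (m + 1), g ((f ^ (m - j)) v) • (f ^ j) Z := by
    intro v
    simp [φ, LinearMap.sum_apply]
  refine ⟨φ, fun u hu => ?_, fun v => ?_, fun v => ?_, fun v hv => ?_, ?_⟩
  · rw [hφ, Finset.sum_eq_zero, smul_zero]
    intro j _
    rw [hgU _ (pow_mem_of_stable hU _ _ hu), zero_smul]
  · rw [hφ]
    exact E.smul_mem _ (E.sum_mem fun j _ => E.smul_mem _ (pow_mem_of_stable hE _ _ hZE))
  · rw [hφ v, map_smul, map_sum, Finset.sum_eq_zero, smul_zero]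
    intro i _
    rw [map_smul, hφ, Finset.sum_eq_zero, smul_zero, smul_zero]
    intro j _
    rw [← Module.End.mul_apply, ← pow_add, hgZ, zero_smul]
  -- After an index shift the two sums differ only in the boundary terms g(f^l v) Z, which is zero,
  -- and g(v) f^l Z, which lies in U.
  · rw [hφ, hφ, map_smul, ← smul_sub, map_sum, Finset.sum_range_succ', Finset.sum_range_succ]
    refine U.smul_mem _ ?_
    have h1 : ∀ j ∈ Finset.range m, g ((f ^ (m - (j + 1))) (f v)) • (f ^ (j + 1)) Z
        = f (g ((f ^ (m - j)) v) • (f ^ j) Z) := by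
      intro j hj
      rw [map_smul, ← Module.End.mul_apply f, ← pow_succ', ← Module.End.mul_apply, ← pow_succ]
      congr 4
      have := Finset.mem_range.mp hj
      omega
    rw [Finset.sum_congr rfl h1, add_sub_add_left_eq_sub, Nat.sub_zero, ← Module.End.mul_apply,
      ← pow_succ, hgU _ (hEl v hv), zero_smul, zero_sub, map_smul, ← Module.End.mul_apply f,
      ← pow_succ']
    exact U.neg_mem (U.smul_mem _ (hEl Z hZE))
  · rw [hφ, Finset.sum_eq_single_of_mem m (by simp)]
    · rw [Nat.sub_self, pow_zero, Module.End.one_apply, smul_smul, inv_mul_cancel₀ hgx, one_smul]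
    · intro j hj hne
      have := Finset.mem_range.mp hj
      rw [hgU _ (pow_mem_of_le hU (i := 1) (by omega) (by simpa using hfx)), zero_smul]

/-- The automorphism `1 + εφ` for a square zero endomorphism `φ`. -/
def unipotent (φ : W →ₗ[ℂ] W) (hφ : ∀ v, φ (φ v) = 0) (ε : ℂ) : W ≃ₗ[ℂ] W :=
  LinearEquiv.ofLinearMap (LinearMap.id + ε • φ) (LinearMap.id - ε • φ)
    (by ext v; simp [hφ]) (by ext v; simp [hφ])

theorem unipotent_apply (φ : W →ₗ[ℂ] W) (hφ : ∀ v, φ (φ v) = 0) (ε : ℂ) (v : W) :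
    unipotent φ hφ ε v = v + ε • φ v := rfl

theorem unipotent_neg_apply (φ : W →ₗ[ℂ] W) (hφ : ∀ v, φ (φ v) = 0) (ε : ℂ) (v : W) :
    unipotent φ hφ ε (v - ε • φ v) = v := by
  simp [unipotent_apply, hφ]

theorem comm_pow_sub_mem {f φ : W →ₗ[ℂ] W} {U E : Submodule ℂ W} (hU : ∀ u ∈ U, f u ∈ U)
    (hE : ∀ v ∈ E, f v ∈ E) (h : ∀ v ∈ E, φ (f v) - f (φ v) ∈ U) (m : ℕ) :
    ∀ v ∈ E, φ ((f ^ m) v) - (f ^ m) (φ v) ∈ U := by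
  induction m with
  | zero => intro v _; simp
  | succ m ih =>
    intro v hv
    have h1 := U.add_mem (h _ (pow_mem_of_stable hE m v hv)) (hU _ (ih v hv))
    rw [map_sub] at h1
    simpa [pow_succ', Module.End.mul_apply] using h1

/-- The flag obtained by moving the members `F_{a+1}, …, F_b` by an automorphism. -/
def CompleteFlag.twist (F : CompleteFlag n W) (a b : ℕ) (g : W ≃ₗ[ℂ] W)
    (ha : ∀ v ∈ F.sp a, g v = v) (hb : ∀ v ∈ F.sp (b + 1), g v ∈ F.sp (b + 1)) :
    CompleteFlag n W where
  space i := if a < (i : ℕ) ∧ (i : ℕ) ≤ b then (F.space i).map (g : W →ₗ[ℂ] W) else F.space i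
  mono i j hij := by
    have hij' : (i : ℕ) ≤ j := hij
    simp only
    split_ifs with h1 h2 h2
    · exact Submodule.map_mono (F.mono hij)
    · rintro _ ⟨v, hv, rfl⟩
      rw [← F.sp_val] at hv ⊢
      exact F.sp_mono (by omega) (hb v (F.sp_mono (by omega) hv))
    · intro v hv
      refine ⟨v, F.mono hij hv, ha v ?_⟩
      rw [← F.sp_val] at hv
      exact F.sp_mono (by omega) hv
    · exact F.mono hij
  finrank_eq i := by
    by_cases h : a < (i : ℕ) ∧ (i : ℕ) ≤ b
    · rw [if_pos h, LinearEquiv.finrank_map_eq, F.finrank_eq]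
    · rw [if_neg h, F.finrank_eq]

theorem CompleteFlag.twist_sp (F : CompleteFlag n W) {a b : ℕ} {g : W ≃ₗ[ℂ] W}
    (ha : ∀ v ∈ F.sp a, g v = v) (hb : ∀ v ∈ F.sp (b + 1), g v ∈ F.sp (b + 1)) {i : ℕ}
    (hi : i ≤ n) : (F.twist a b g ha hb).sp i
      = if a < i ∧ i ≤ b then (F.sp i).map (g : W →ₗ[ℂ] W) else F.sp i := by
  simp [CompleteFlag.sp, CompleteFlag.twist, hi]

/-- On E = F_{b+1} the automorphism commutes with f^m modulo U = F_a, where it is the identity, so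
inclusions between moved members persist. By `hij` and `hji`, if only the source is moved, the
target is U or contains E; if only the target is moved, the source lies in U or is E. -/
theorem CompleteFlag.pow_mem_twist (F : CompleteFlag n W) {a b : ℕ} {f φ : W →ₗ[ℂ] W} {ε : ℂ}
    (hφ : ∀ v, φ (φ v) = 0) (hφE : ∀ v, φ v ∈ F.sp (b + 1))
    (hU : ∀ u ∈ F.sp a, f u ∈ F.sp a) (hE : ∀ v ∈ F.sp (b + 1), f v ∈ F.sp (b + 1))
    (hcomm : ∀ v ∈ F.sp (b + 1), φ (f v) - f (φ v) ∈ F.sp a)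
    (h1 : ∀ v ∈ F.sp a, unipotent φ hφ ε v = v)
    (h2 : ∀ v ∈ F.sp (b + 1), unipotent φ hφ ε v ∈ F.sp (b + 1)) {i j m : ℕ}
    (hi : i ≤ n) (hj : j ≤ n)
    (h : ∀ v ∈ F.sp i, (f ^ m) v ∈ F.sp j) (hij : a < i → i ≤ b → a ≤ j)
    (hji : a < j → j ≤ b → i ≤ b + 1) :
    ∀ v ∈ (F.twist a b (unipotent φ hφ ε) h1 h2).sp i,
      (f ^ m) v ∈ (F.twist a b (unipotent φ hφ ε) h1 h2).sp j := by
  have key : ∀ v ∈ F.sp (b + 1), ∃ u ∈ F.sp a,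
      (f ^ m) (unipotent φ hφ ε v) = unipotent φ hφ ε ((f ^ m) v + u) := by
    intro v hv
    have h3 := comm_pow_sub_mem hU hE hcomm m v hv
    refine ⟨-ε • (φ ((f ^ m) v) - (f ^ m) (φ v)), (F.sp a).smul_mem _ h3, ?_⟩
    rw [map_add, h1 _ ((F.sp a).smul_mem _ h3), unipotent_apply, unipotent_apply, map_add, map_smul]
    module
  rw [F.twist_sp h1 h2 hi, F.twist_sp h1 h2 hj]
  split_ifs with h3 h4 h4
  · rintro _ ⟨v, hv, rfl⟩
    obtain ⟨u, hu, hm⟩ := key v (F.sp_mono (by omega) hv)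
    exact ⟨(f ^ m) v + u, (F.sp j).add_mem (h v hv) (F.sp_mono (by omega) hu), hm.symm⟩
  · rintro _ ⟨v, hv, rfl⟩
    have hvE : v ∈ F.sp (b + 1) := F.sp_mono (by omega) hv
    rcases (hij h3.1 h3.2).eq_or_lt with h5 | h5
    · obtain ⟨u, hu, hm⟩ := key v hvE
      have h6 : (f ^ m) v + u ∈ F.sp a := (F.sp a).add_mem (by rw [h5]; exact h v hv) hu
      rw [← h5]
      change (f ^ m) (unipotent φ hφ ε v) ∈ _
      rw [hm, h1 _ h6]
      exact h6
    · exact F.sp_mono (by omega) (pow_mem_of_stable hE m _ (h2 v hvE))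
  · intro v hv
    rcases le_or_gt i a with h5 | h5
    · have h6 := pow_mem_of_stable hU m v (F.sp_mono h5 hv)
      exact ⟨_, F.sp_mono h4.1.le h6, h1 _ h6⟩
    · have h6 : i = b + 1 := by have := hji h4.1 h4.2; omega
      subst h6
      have hv' : v - ε • φ v ∈ F.sp (b + 1) :=
        (F.sp (b + 1)).sub_mem hv ((F.sp (b + 1)).smul_mem _ (hφE v))
      obtain ⟨u, hu, hm⟩ := key _ hv'
      rw [unipotent_neg_apply] at hm
      exact ⟨_, (F.sp j).add_mem (h _ hv') (F.sp_mono h4.1.le hu), hm.symm⟩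
  · exact h

end Perturbation

theorem tendsto_twist {W : Type*} [NormedAddCommGroup W] [InnerProductSpace ℂ W]
    [FiniteDimensional ℂ W] (F : CompleteFlag n W) {a b : ℕ} {φ : W →ₗ[ℂ] W}
    (hφ : ∀ v, φ (φ v) = 0) (h1 : ∀ ε, ∀ v ∈ F.sp a, unipotent φ hφ ε v = v)
    (h2 : ∀ ε, ∀ v ∈ F.sp (b + 1), unipotent φ hφ ε v ∈ F.sp (b + 1)) :
    Tendsto (fun ε => F.twist a b (unipotent φ hφ ε) (h1 ε) (h2 ε)) (𝓝[≠] 0) (𝓝 F) := by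
  refine tendsto_flag fun i hi v hv => ?_
  refine ⟨fun ε => if a < i ∧ i ≤ b then v + ε • φ v else v, Eventually.of_forall fun ε => ?_, ?_⟩
  · rw [F.twist_sp _ _ hi]
    split_ifs
    · exact ⟨v, hv, rfl⟩
    · exact hv
  · split_ifs
    · have h3 : Tendsto (fun ε : ℂ => ε) (𝓝[≠] 0) (𝓝 0) :=
        tendsto_nhdsWithin_of_tendsto_nhds tendsto_id
      simpa using (h3.smul_const (φ v)).const_add v
    · exact tendsto_const_nhds

theorem N_pow_pq_inl {m : ℕ} {i j : Fin (n - k)} (h : (j : ℕ) + m = i) :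
    (N n k ^ m) (pq n k (Sum.inl i)) = pq n k (Sum.inl j) := by
  refine coord_ext (fun r => ?_) (fun r => ?_)
  · rw [coordP_N_pow, coordP_pq_inl, coordP_pq_inl]
    congr 1
    simp only [eq_iff_iff]
    omega
  · rw [coordQ_N_pow, coordQ_pq_inl, coordQ_pq_inl]

/-! ### Density of the attracting set in the oriented cup variety. -/

namespace RowStrictTableau

variable {w : RowStrictTableau n k} {D : CupDiagram n}

/-- Induction on the last point. A cup relation or the Springer condition transports bounds from an
earlier member, and clockwise left ends are fixed by definition. Only the P-bound after a
counter-clockwise left end and the Q-bound after a ray do not follow in this way; the first is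
`hgen`. -/
theorem Adapted.bounds_of_generic (h : w.Adapted D) {F : CompleteFlag n (V n k)}
    (hF : F ∈ w.orientedCupVariety D) {i : ℕ} (hi : i ≤ n)
    (hgen : ∀ a, a ∈ w.vee → a < D.partner a → (a : ℕ) < i → w.BoundP F (a + 1)) :
    w.BoundP F i ∧ w.BoundQ F i := by
  obtain ⟨⟨hY, hcup⟩, hfix⟩ := hF
  have hN := (mem_springerFiber_iff w.card_le).mp hY
  induction i using Nat.strong_induction_on with
  | _ i ih =>
  rcases Nat.eq_zero_or_pos i with rfl | hpos
  · constructor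
    · intro v hv _ j _
      rw [F.sp_zero, Submodule.mem_bot] at hv
      rw [hv, map_zero]
    · intro v hv j _
      rw [F.sp_zero, Submodule.mem_bot] at hv
      rw [hv, map_zero]
  obtain ⟨y, rfl⟩ : ∃ z, i = z + 1 := ⟨i - 1, by omega⟩
  set j : Fin n := ⟨y, by omega⟩ with hj
  have hjy : (j : ℕ) = y := rfl
  rw [← hjy] at hgen ⊢
  have ihj := ih j (by omega) (by omega) fun a ha hlt hai => hgen a ha hlt (by omega)
  rcases lt_trichotomy (D.partner j) j with hjp | hjp | hjp
  · set c := D.partner j with hc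
    have hcj : D.partner c = j := D.partner_partner j
    have hlt : c < D.partner c := by rwa [hcj]
    obtain ⟨l, -, hl, ht, hb⟩ := h.orients.count_cup hlt
    have hlt' : (c : ℕ) < j := hjp
    have hrel := hcup c hlt l hl
    have ihc := ih c (by omega) (by omega) fun a ha hlt hai => hgen a ha hlt (by omega)
    rw [hcj] at hrel ht hb
    constructor
    · intro v hv hvQ r hr
      have := ihc.1 _ (hrel v hv) (fun r => by rw [coordQ_N_pow, hvQ]) (r - l) (by omega)
      rwa [coordP_N_pow, Nat.sub_add_cancel (by omega)] at this
    · intro v hv r hr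
      have := ihc.2 _ (hrel v hv) (r - l) (by omega)
      rwa [coordQ_N_pow, Nat.sub_add_cancel (by omega)] at this
  · have hjw := h.ray j hjp
    have ht := w.tN_succ_of_mem_wedge hjw
    have hle := w.tN_le (j + 1)
    constructor
    · intro v hv hvQ r hr
      have := ihj.1 _ (hN _ v hv) (fun r => by rw [coordQ_N, hvQ]) (r - 1) (by omega)
      rwa [coordP_N, Nat.sub_add_cancel (by omega)] at this
    -- Beyond the ray there are only further ∧-rays and complete cups, so a power of N with exponent
    -- the number of remaining ∧'s sends V into F_{j+1}, and the last p to this vector. The step at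
    -- the ray is then spanned by a vector of P.
    · have hmem : pq n k (Sum.inl ⟨w.tN j, by omega⟩) ∈ F.sp (j + 1) := by
        have h1 := h.orients.N_pow_mem_of_cupRel hY (x := j + 1) (y := n) (by omega) le_rfl
          (fun c _ hc _ => hcup c hc) (fun i hi hin hp => ?_) (fun i _ _ => (D.partner i).isLt)
          (pq n k (Sum.inl ⟨n - k - 1, by omega⟩)) (by rw [F.sp_of_le w.card_le le_rfl]; trivial)
        · rwa [N_pow_pq_inl (j := ⟨w.tN j, by omega⟩)] at h1
          rw [tN_last]
          simp only
          omega
        · rcases hp with hp | hp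
          · exfalso
            rcases (show (D.partner i : ℕ) ≤ j by omega).eq_or_lt with h2 | h2
            · have h3 := congrArg D.partner (Fin.ext h2)
              rw [D.partner_partner, hjp] at h3
              rw [h3] at hi
              omega
            · exact (D.crossingless (D.partner i) j h2
                (by rw [D.partner_partner]; exact Fin.lt_def.mpr (by omega))).1 hjp
          · exact h.ray i hp
      have hnot : pq n k (Sum.inl ⟨w.tN j, by omega⟩) ∉ F.sp j := fun hm => by
        have := ihj.1 _ hm (fun _ => coordQ_pq_inl _ _) (w.tN j) le_rfl
        simp [coordP_pq_inl] at this
      intro v hv r hr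
      rw [F.sp_succ_eq_sup j.isLt hmem hnot, Submodule.mem_sup] at hv
      obtain ⟨u, hu, z, hz, rfl⟩ := hv
      obtain ⟨c, rfl⟩ := Submodule.mem_span_singleton.mp hz
      rw [bN_succ_of_mem_wedge hjw] at hr
      rw [map_add, map_smul, coordQ_pq_inl, smul_zero, add_zero]
      exact ihj.2 u hu r hr
  · rcases w.mem_wedge_or_mem_vee j with hjw | hjv
    · have h1 := hfix j hjw hjp
      constructor
      · intro v hv _ r hr
        rw [h1, mem_fixedFlag_sp (by omega)] at hv
        exact hv.1 r hr
      · intro v hv r hr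
        rw [h1, mem_fixedFlag_sp (by omega)] at hv
        exact hv.2 r hr
    · refine ⟨hgen j hjv hjp (by omega), fun v hv r hr => ?_⟩
      rw [bN_succ_of_mem_vee hjv] at hr
      have := ihj.2 _ (hN _ v hv) (r - 1) (by omega)
      rwa [coordQ_N, Nat.sub_add_cancel (by omega)] at this

/-- The flags of the oriented cup variety in general position at the counter-clockwise cups whose
left ends precede `m`. -/
def genericSet (w : RowStrictTableau n k) (D : CupDiagram n) (m : ℕ) :
    Set (CompleteFlag n (V n k)) :=
  {F | F ∈ w.orientedCupVariety D ∧
    ∀ a, a ∈ w.vee → a < D.partner a → (a : ℕ) < m → w.BoundP F (a + 1)}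

/-- Other cups are nested with the cup at `a` or disjoint from it, as the twisting lemma requires.
By `inner` no clockwise left end lies below this cup, so the prescribed members do not move. -/
theorem Adapted.twist_mem_orientedCupVariety (h : w.Adapted D) {F : CompleteFlag n (V n k)}
    (hF : F ∈ w.orientedCupVariety D) {a : Fin n} (ha : a ∈ w.vee) (hlt : a < D.partner a)
    {φ : V n k →ₗ[ℂ] V n k} {ε : ℂ} (hφ : ∀ v, φ (φ v) = 0)
    (hφE : ∀ v, φ v ∈ F.sp (D.partner a + 1))
    (hcomm : ∀ v ∈ F.sp (D.partner a + 1), φ (N n k v) - N n k (φ v) ∈ F.sp a)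
    (h1 : ∀ v ∈ F.sp a, unipotent φ hφ ε v = v)
    (h2 : ∀ v ∈ F.sp (D.partner a + 1), unipotent φ hφ ε v ∈ F.sp (D.partner a + 1)) :
    F.twist a (D.partner a) (unipotent φ hφ ε) h1 h2 ∈ w.orientedCupVariety D := by
  obtain ⟨⟨hY, hcup⟩, hfix⟩ := hF
  have hlt' : (a : ℕ) < D.partner a := hlt
  have hN := (mem_springerFiber_iff w.card_le).mp hY
  have hst : ∀ i, ∀ v ∈ F.sp i, N n k v ∈ F.sp i := fun i v hv =>
    hN i v (F.sp_mono (Nat.le_succ i) hv)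
  refine ⟨⟨(mem_springerFiber_iff w.card_le).mpr fun i => ?_, fun c hc l hl => ?_⟩,
    fun c hcw hc => ?_⟩
  · rcases lt_or_ge i n with hi | hi
    · have := F.pow_mem_twist hφ hφE (hst _) (hst _) hcomm h1 h2 (i := i + 1) (j := i)
        (m := 1) (by omega) (by omega) (by simpa using hN i) (by omega) (by omega)
      simpa using this
    · intro v _
      rw [CompleteFlag.sp_of_le _ w.card_le hi]
      trivial
  · have hc' : (c : ℕ) < D.partner c := hc
    refine F.pow_mem_twist hφ hφE (hst _) (hst _) hcomm h1 h2 (by omega) (by omega)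
      (hcup c hc l hl) (fun h3 h4 => ?_) (fun h3 h4 => ?_)
    · by_contra h5
      rcases (show (a : ℕ) ≤ D.partner c by omega).eq_or_lt with h6 | h6
      · rw [Fin.ext h6, D.partner_partner] at hlt'
        omega
      · have := D.lt_partner_of_mem (i := a) (j := D.partner c) h6 (Fin.lt_def.mpr (by omega))
        rw [D.partner_partner] at this
        have : (a : ℕ) < c := this.1
        omega
    · have := (D.partner_mem_Icc (a := a) (j := c) (Fin.le_def.mpr (by omega)) h4).2
      have : (D.partner c : ℕ) ≤ D.partner a := this
      omega
  · rw [F.twist_sp h1 h2 (by omega), if_neg, hfix c hcw hc]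
    rintro ⟨h3, h4⟩
    have h5 : (c : ℕ) ≠ a := fun h5 => notMem_vee_of_mem_wedge hcw (by rwa [Fin.ext h5])
    exact notMem_vee_of_mem_wedge hcw (h.inner a c ha (Fin.lt_def.mpr (by omega))
      (Fin.lt_def.mpr (by omega)) hc)

/-- Vectors of P that N sends into F_a exceed F_a ∩ P by at most one dimension, which `x` already
accounts for. If c ≠ 0, then u + c z is such a vector, so it lies in F_{a+1}, forcing z into
F_{a+1}. -/
theorem Adapted.boundP_of_perturbed (h : w.Adapted D) {F : CompleteFlag n (V n k)} {a : Fin n}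
    (hF : F ∈ w.genericSet D a) {x z : V n k} (hx : x ∈ F.sp (a + 1))
    (hxQ : ∀ j, coordQ n k j x = 0) {j : ℕ} (hj : w.tN a ≤ j) (hxj : coordP n k j x ≠ 0)
    (hz : N n k z ∈ F.sp a) (hzA : z ∉ F.sp (a + 1)) {u : V n k} (hu : u ∈ F.sp a) {c : ℂ}
    (hQ : ∀ j, coordQ n k j (u + c • (x + z)) = 0) :
    ∀ j, w.tN a ≤ j → coordP n k j (u + c • (x + z)) = 0 := by
  have hN := (mem_springerFiber_iff w.card_le).mp hF.1.1.1
  have hb := h.bounds_of_generic hF.1 (i := a) (by omega) fun b hb hlt hba => hF.2 b hb hlt hba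
  have hsat := (saturated_of_bounds (by omega) hb.1 hb.2).1
  by_cases hc : c = 0
  · subst hc
    rw [zero_smul, add_zero] at hQ ⊢
    exact hb.1 u hu hQ
  exfalso
  have hPN : ∀ y, N n k y ∈ F.sp a → (∀ j, coordQ n k j y = 0) → ∀ j, w.tN a + 1 ≤ j →
      coordP n k j y = 0 := by
    intro y hy hyQ j hj
    have := hb.1 _ hy (fun i => by rw [coordQ_N, hyQ]) (j - 1) (by omega)
    rwa [coordP_N, Nat.sub_add_cancel (by omega)] at this
  have hxt : coordP n k (w.tN a) x ≠ 0 := by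
    rcases hj.eq_or_lt with h1 | h1
    · rwa [h1]
    · exact absurd (hPN x (hN a x hx) hxQ j h1) hxj
  set y := u + c • z with hy
  have hyQ : ∀ j, coordQ n k j y = 0 := by
    intro j
    have := hQ j
    rw [hy]
    simpa [smul_add, hxQ] using this
  have hyN : N n k y ∈ F.sp a := by
    rw [hy, map_add, map_smul]
    exact (F.sp a).add_mem (hN a u (F.sp_mono (Nat.le_succ _) hu)) ((F.sp a).smul_mem _ hz)
  have hmem : y - (coordP n k (w.tN a) y / coordP n k (w.tN a) x) • x ∈ F.sp a := by
    refine hsat _ (fun j => by simp [hyQ, hxQ]) fun j hj => ?_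
    rcases hj.eq_or_lt with h1 | h1
    · rw [← h1, map_sub, map_smul, smul_eq_mul, div_mul_cancel₀ _ hxt, sub_self]
    · rw [map_sub, map_smul, hPN y hyN hyQ j h1, hPN x (hN a x hx) hxQ j h1, smul_zero, sub_zero]
  have hcz : c • z ∈ F.sp (a + 1) := by
    have h1 := (F.sp (a + 1)).add_mem (F.sp_mono (Nat.le_succ _) hmem)
      ((F.sp (a + 1)).smul_mem (coordP n k (w.tN a) y / coordP n k (w.tN a) x) hx)
    rw [sub_add_cancel, hy] at h1
    exact ((F.sp (a + 1)).add_mem_iff_right (F.sp_mono (Nat.le_succ _) hu)).mp h1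
  exact hzA (((F.sp (a + 1)).smul_mem_iff hc).mp hcz)

/-- If the bound fails at `a`, a vector `x` of P witnesses this and spans the step after F_a.
Tilting that step towards N^(l-1) Z, outside F_{a+1}, restores the bound for every ε ≠ 0 and leaves
the members up to F_a alone. -/
theorem Adapted.genericSet_subset_closure (h : w.Adapted D) {m : ℕ} (hm : m < n) :
    w.genericSet D m ⊆ closure (w.genericSet D (m + 1)) := by
  intro F hF
  set a : Fin n := ⟨m, hm⟩ with ham
  have hav : (a : ℕ) = m := rfl
  by_cases hgood : a ∈ w.vee → a < D.partner a → w.BoundP F (a + 1)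
  · refine subset_closure ⟨hF.1, fun b hb hlt hbm => ?_⟩
    rcases (show (b : ℕ) ≤ a by omega).eq_or_lt with h1 | h1
    · rw [Fin.ext h1] at hb hlt ⊢
      exact hgood hb hlt
    · exact hF.2 b hb hlt h1
  push Not at hgood
  obtain ⟨ha, hlt, hbad⟩ := hgood
  have hlt' : (a : ℕ) < D.partner a := hlt
  rw [BoundP] at hbad
  push Not at hbad
  obtain ⟨x, hx, hxQ, j, hj, hxj⟩ := hbad
  rw [tN_succ_of_mem_vee ha] at hj
  rw [← hav] at hF ⊢
  have hN := (mem_springerFiber_iff w.card_le).mp hF.1.1.1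
  have hst : ∀ i, ∀ v ∈ F.sp i, N n k v ∈ F.sp i := fun i v hv =>
    hN i v (F.sp_mono (Nat.le_succ i) hv)
  have hb := h.bounds_of_generic hF.1 (i := a) (by omega) fun b hb hlt hba => hF.2 b hb hlt hba
  have hxa : x ∉ F.sp a := fun hxa => hxj (hb.1 x hxa hxQ j hj)
  obtain ⟨l, hl0, hl, -, -⟩ := h.orients.count_cup hlt
  have hrel := hF.1.1.2 a hlt l hl
  -- N^(l-1) maps the (a + 2l)-dimensional member onto a space of dimension at least a + 2, too
  -- large for F_{a+1}.
  obtain ⟨Z, hZE, hZ⟩ : ∃ Z ∈ F.sp (D.partner a + 1), (N n k ^ (l - 1)) Z ∉ F.sp (a + 1) := by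
    by_contra! hcon
    have h1 : (F.sp (D.partner a + 1)).map (N n k ^ (l - 1)) ≤ F.sp (a + 1) := by
      rintro _ ⟨v, hv, rfl⟩
      exact hcon v hv
    have h2 := Submodule.finrank_mono h1
    have h3 := finrank_le_finrank_map_N_pow (l - 1) (F.sp (D.partner a + 1))
    rw [F.finrank_sp (by omega)] at h2 h3
    omega
  obtain ⟨φ, hφU, hφE, hφ, hcomm, hφx⟩ := exists_perturbation (hst _) (hst _)
    (F.sp_mono (Nat.le_succ a)) hxa hx (hN a x hx) hl0 hrel hZE hZ
  have h1 : ∀ ε, ∀ v ∈ F.sp a, unipotent φ hφ ε v = v := by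
    intro ε v hv
    rw [unipotent_apply, hφU v hv, smul_zero, add_zero]
  have h2 : ∀ ε, ∀ v ∈ F.sp (D.partner a + 1),
      unipotent φ hφ ε v ∈ F.sp (D.partner a + 1) := fun ε v hv =>
    Submodule.add_mem _ hv (Submodule.smul_mem _ _ (hφE v))
  refine mem_closure_of_tendsto (tendsto_twist F hφ h1 h2) ?_
  filter_upwards [self_mem_nhdsWithin] with ε hε
  refine ⟨h.twist_mem_orientedCupVariety hF.1 ha hlt hφ hφE hcomm _ _, fun b hb hltb hbm => ?_⟩
  rw [BoundP, F.twist_sp _ _ (by omega)]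
  rcases (show (b : ℕ) ≤ a by omega).eq_or_lt with h3 | h3
  · obtain rfl := Fin.ext h3
    rw [if_pos (by omega), F.sp_succ_eq_sup (by omega) hx hxa, tN_succ_of_mem_vee ha]
    rintro _ ⟨v, hv, rfl⟩ hQ
    obtain ⟨u, hu, y, hy, rfl⟩ := Submodule.mem_sup.mp hv
    obtain ⟨c, rfl⟩ := Submodule.mem_span_singleton.mp hy
    have h4 : unipotent φ hφ ε (u + c • x) = u + c • (x + ε • (N n k ^ (l - 1)) Z) := by
      rw [unipotent_apply, map_add, map_smul, hφU u hu, hφx]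
      module
    change ∀ j, coordQ n k j (unipotent φ hφ ε (u + c • x)) = 0 at hQ
    change ∀ j, _ → coordP n k j (unipotent φ hφ ε (u + c • x)) = 0
    rw [h4] at hQ ⊢
    refine h.boundP_of_perturbed hF hx hxQ hj hxj ?_ ?_ hu hQ
    · rw [map_smul, ← Module.End.mul_apply, ← pow_succ', Nat.sub_add_cancel hl0]
      exact Submodule.smul_mem _ _ (hrel Z hZE)
    · rwa [Submodule.smul_mem_iff _ hε]
  · rw [if_neg (by omega)]
    exact hF.2 b hb hltb h3

theorem Adapted.orientedCupVariety_subset_closure (h : w.Adapted D) :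
    w.orientedCupVariety D ⊆ closure w.attractingSet := by
  have key : ∀ m ≤ n, w.orientedCupVariety D ⊆ closure (w.genericSet D m) := by
    intro m
    induction m with
    | zero => exact fun _ F hF => subset_closure ⟨hF, fun _ _ _ h => absurd h (Nat.not_lt_zero _)⟩
    | succ m ih =>
      exact fun hm => (ih (by omega)).trans
        (closure_minimal (h.genericSet_subset_closure (by omega)) isClosed_closure)
  refine (key n le_rfl).trans (closure_mono fun F hF => ?_)
  exact mem_attractingSet_iff.mpr ⟨hF.1.1.1, fun i hi =>
    h.bounds_of_generic hF.1 hi fun a ha hlt _ => hF.2 a ha hlt a.isLt⟩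

theorem Adapted.stableManifold_eq (h : w.Adapted D) :
    w.stableManifold = w.orientedCupVariety D :=
  Set.Subset.antisymm (closure_minimal h.attractingSet_subset isClosed_orientedCupVariety)
    h.orientedCupVariety_subset_closure

end RowStrictTableau

/-! ### Components attached to standard tableaux. -/

theorem comap_pow_succ {W : Type*} [AddCommGroup W] [Module ℂ W] (f : W →ₗ[ℂ] W)
    (U : Submodule ℂ W) (j : ℕ) :
    U.comap (f ^ (j + 1)) = (U.comap (f ^ j)).comap f := by
  ext v
  simp [pow_succ]

section Concavity

variable {W : Type*} [AddCommGroup W] [Module ℂ W] [FiniteDimensional ℂ W]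

theorem finrank_inf_add_le {A B R : Submodule ℂ W} (h : A ≤ B) :
    Module.finrank ℂ (B ⊓ R : Submodule ℂ W) + Module.finrank ℂ A
      ≤ Module.finrank ℂ B + Module.finrank ℂ (A ⊓ R : Submodule ℂ W) := by
  rw [← Submodule.finrank_sup_add_finrank_inf_eq]
  refine add_le_add (Submodule.finrank_mono (sup_le inf_le_left h)) (Submodule.finrank_mono ?_)
  exact le_inf inf_le_right (inf_le_left.trans inf_le_right)

/-- The dimensions of the preimages of U under f^j are concave in j; if the last increment is at
least 2, so are all earlier ones. -/
theorem le_finrank_comap_pow (f : W →ₗ[ℂ] W) {U : Submodule ℂ W} (hU : ∀ u ∈ U, f u ∈ U) (c : ℕ)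
    (h : Module.finrank ℂ (U.comap (f ^ c)) + 2 ≤ Module.finrank ℂ (U.comap (f ^ (c + 1)))) :
    Module.finrank ℂ U + 2 * (c + 1) ≤ Module.finrank ℂ (U.comap (f ^ (c + 1))) := by
  induction c with
  | zero =>
    have : U.comap (f ^ 0) = U := by ext; simp
    rw [this] at h
    simpa using h
  | succ c ih =>
    have h1 : U.comap (f ^ c) ≤ U.comap (f ^ (c + 1)) := by
      intro v hv
      rw [Submodule.mem_comap, pow_succ', Module.End.mul_apply]
      exact hU _ hv
    have h2 := finrank_inf_add_le (R := LinearMap.range f) h1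
    have h3 := finrank_comap_add f (U.comap (f ^ c))
    have h4 := finrank_comap_add f (U.comap (f ^ (c + 1)))
    rw [← comap_pow_succ] at h3 h4
    have := ih (by omega)
    omega

/-- The image of f^c modulo U has the dimension of the last increment in the chain of preimages of
U. By concavity an increment of 2 or more would make W too large. -/
theorem finrank_sup_range_pow_le (f : W →ₗ[ℂ] W) {U : Submodule ℂ W} (hU : ∀ u ∈ U, f u ∈ U)
    {c : ℕ} (hc : ∀ v, (f ^ (c + 1)) v ∈ U)
    (hd : Module.finrank ℂ W < Module.finrank ℂ U + 2 * (c + 1)) :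
    Module.finrank ℂ (U ⊔ LinearMap.range (f ^ c) : Submodule ℂ W) ≤ Module.finrank ℂ U + 1 := by
  by_contra hcon
  have h1 := Submodule.finrank_sup_add_finrank_inf_eq U (LinearMap.range (f ^ c))
  have h2 := LinearMap.finrank_range_add_finrank_ker (f ^ c)
  have h3 := finrank_comap_add (f ^ c) U
  have h4 : U.comap (f ^ (c + 1)) = ⊤ := by
    rw [eq_top_iff]
    exact fun v _ => hc v
  have h5 := le_finrank_comap_pow f hU c
  rw [h4, finrank_top] at h5
  have := h5 (by omega)
  omega

end Concavity

namespace RowStrictTableau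

variable {S w : RowStrictTableau n k} {D : CupDiagram n}

theorem adapted_of_vee_eq_leftEnds (h : S.vee = D.leftEnds) : S.Adapted D where
  orients i hi := by
    refine Or.inl ⟨h ▸ hi, notMem_vee_iff.mp fun h1 => ?_⟩
    rw [h] at h1
    have h2 : D.partner i < D.partner (D.partner i) := h1
    rw [D.partner_partner] at h2
    exact lt_asymm hi h2
  ray i hi := notMem_vee_iff.mp fun h1 => by
    rw [h] at h1
    have h2 : i < D.partner i := h1
    rw [hi] at h2
    exact lt_irrefl _ h2
  inner a i _ _ _ hi := by rw [h]; exact hi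
  sep i j _ _ hj hj' := by
    rw [h] at hj
    exact absurd hj (not_lt.mpr hj')

theorem IsStandard.le_bN_top (hS : S.IsStandard) (c : Fin (n - k)) :
    k ≤ S.bN (S.top c) + c := by
  by_contra hlt
  have h1 := hS c ⟨c, by omega⟩ rfl
  have h2 := S.bN_bot ⟨c, by omega⟩
  have h3 := S.bN_succ_of_mem_vee (j := S.bot ⟨c, by omega⟩) ⟨_, rfl⟩
  have h4 : S.bN (S.bot ⟨c, by omega⟩ + 1) ≤ S.bN (S.top c) := countBelow_mono _ h1
  simp only at h2
  omega

theorem mem_openComponent_iff {F : CompleteFlag n (V n k)} :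
    F ∈ S.openComponent ↔ F ∈ springerFiber n k ∧
      (∀ c : Fin (n - k), F.sp (S.top c + 1) ≤
        F.sp (S.top c) ⊔ LinearMap.range (N n k ^ (c : ℕ))) ∧
      (∀ c : Fin k, F.sp (S.bot c + 1) ≤
        F.sp (S.bot c) ⊔ LinearMap.range (N n k ^ (c : ℕ))) := by
  simp only [F.sp_succ, F.sp_castSucc]
  rfl

/-- At a top entry in column c (from 0), F_{j+1} ⊆ F_j + im N^c. Standardness gives dim F_j ≥ n - 2c
- 1, so the sum exceeds F_j by at most one dimension and equals F_{j+1}, which therefore contains im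
N^c. The start of the induction, N^(n-k) = 0, uses `2 * k ≤ n`. -/
theorem IsStandard.range_le_sp (hS : S.IsStandard) (hnk : 2 * k ≤ n) {F : CompleteFlag n (V n k)}
    (hF : F ∈ S.openComponent) {i : ℕ} (hi : i ≤ n) :
    LinearMap.range (N n k ^ (n - k - S.tN i)) ≤ F.sp i := by
  obtain ⟨hY, htop, -⟩ := mem_openComponent_iff.mp hF
  have hN := (mem_springerFiber_iff S.card_le).mp hY
  induction i with
  | zero =>
    rintro _ ⟨v, rfl⟩
    rw [F.sp_zero, Submodule.mem_bot, tN, countBelow_zero]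
    exact coord_ext (fun j => by rw [coordP_N_pow, coordP_of_le (by omega), map_zero])
      (fun j => by rw [coordQ_N_pow, coordQ_of_le (by omega), map_zero])
  | succ i ih =>
    have ihi := ih (by omega)
    set j : Fin n := ⟨i, by omega⟩ with hj
    have hji : (j : ℕ) = i := rfl
    rw [← hji] at ihi ⊢
    rcases S.mem_wedge_or_mem_vee j with hjw | hjv
    · obtain ⟨c, hc⟩ := hjw
      have h1 := S.tN_top c
      have h2 := hS.le_bN_top c
      have h3 := htop c
      have h4 := S.tN_succ_of_mem_wedge (j := S.top c) ⟨c, rfl⟩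
      have h5 := S.tN_add_bN (i := S.top c) (by omega)
      rw [hc] at h1 h2 h3 h4 h5
      rw [show n - k - S.tN j = c + 1 by omega] at ihi
      rw [show n - k - S.tN (j + 1) = c by omega]
      have h6 := finrank_sup_range_pow_le (N n k) (U := F.sp j)
        (fun u hu => hN j u (F.sp_mono (Nat.le_succ _) hu)) (c := c)
        (fun v => ihi ⟨v, rfl⟩) (by rw [F.finrank_sp (by omega), finrank_V S.card_le]; omega)
      rw [F.finrank_sp (by omega)] at h6
      rw [F.sp_eq_of_le (by omega) h6 h3]
      exact le_sup_right
    · rw [tN_succ_of_mem_vee hjv]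
      exact ihi.trans (F.sp_mono (Nat.le_succ _))

/-- As for attracting sets, but the step at the right end now comes from the tableau condition: it
lies in im N^c modulo F_b, and N^(l+c) V ⊆ F_a because l + c = n - k - t_a. -/
theorem IsStandard.openComponent_subset (hS : S.IsStandard) (hnk : 2 * k ≤ n)
    (hD : S.vee = D.leftEnds) : S.openComponent ⊆ D.cupVariety k := by
  intro F hF
  obtain ⟨hY, htop, -⟩ := mem_openComponent_iff.mp hF
  refine ⟨hY, fun a hlt => ?_⟩
  have had := adapted_of_vee_eq_leftEnds hD
  induction hm : (D.partner a : ℕ) - a using Nat.strong_induction_on generalizing a with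
  | _ m ih =>
  subst hm
  have h0 : (a : ℕ) < D.partner a := hlt
  intro l hl v hv
  have ha : a ∈ S.vee := hD ▸ hlt
  have hb : D.partner a ∈ S.wedge := (had.orients.partner_mem_wedge_iff hlt.ne').mpr ha
  have h1 := had.orients.N_pow_mem_of_inner hY ha hlt (fun c h1 h2 h3 =>
    ih _ (by have : (c : ℕ) < D.partner c := h2; omega) c h2 rfl) hl
  obtain ⟨l', -, hl', ht, -⟩ := had.orients.count_cup hlt
  obtain rfl : l = l' := by omega
  rw [tN_succ_of_mem_wedge hb] at ht
  obtain ⟨c, hc⟩ := hb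
  have h2 := htop c
  have h3 := S.tN_top c
  rw [hc] at h2 h3
  obtain ⟨u, hu, z, ⟨y, rfl⟩, rfl⟩ := Submodule.mem_sup.mp (h2 hv)
  rw [map_add]
  refine Submodule.add_mem _ (h1 u hu) ?_
  rw [N_pow_N_pow, show l + c = n - k - S.tN a by omega]
  exact hS.range_le_sp hnk hF (by omega) ⟨y, rfl⟩

/-- From the right: crossing a whole cup applies N^l and changes b by l, while at a ∧ the exponent
is unchanged. -/
theorem sp_le_range_of_mem_cupVariety (hD : S.vee = D.leftEnds) {F : CompleteFlag n (V n k)}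
    (hF : F ∈ D.cupVariety k) {x : ℕ} (hx : x ≤ n) :
    F.sp x ≤ LinearMap.range (N n k ^ (k - S.bN x)) := by
  have had := adapted_of_vee_eq_leftEnds hD
  induction hm : n - x using Nat.strong_induction_on generalizing x with
  | _ m ih =>
  subst hm
  rcases hx.eq_or_lt with rfl | hlt
  · rw [bN_last, Nat.sub_self, pow_zero, Module.End.one_eq_id, LinearMap.range_id]
    exact le_top
  set j : Fin n := ⟨x, by omega⟩ with hj
  have hjx : (j : ℕ) = x := rfl
  rw [← hjx] at ih ⊢
  rcases S.mem_wedge_or_mem_vee j with hjw | hjv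
  · have h1 := ih _ (by omega) (x := j + 1) (by omega) rfl
    rw [bN_succ_of_mem_wedge hjw] at h1
    exact (F.sp_mono (Nat.le_succ _)).trans h1
  · have hjp : j < D.partner j := by rw [hD] at hjv; exact hjv
    have h0 : (j : ℕ) < D.partner j := hjp
    obtain ⟨l, -, hl, -, hb⟩ := had.orients.count_cup hjp
    have h1 := ih _ (by omega) (x := D.partner j + 1) (by omega) rfl
    rw [map_eq_of_cupRel (hF.2 j hjp) hl]
    rintro _ ⟨v, hv, rfl⟩
    obtain ⟨u, rfl⟩ := h1 hv
    refine ⟨u, ?_⟩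
    rw [N_pow_N_pow]
    have := S.bN_le (D.partner j + 1)
    congr 2
    omega

/-- At a top entry the step is spanned by a basis vector of the form N^c p_{n-k}; at a bottom entry
the whole member lies in im N^c. -/
theorem attractingSet_subset_openComponent (hD : S.vee = D.leftEnds) :
    S.attractingSet ⊆ S.openComponent := by
  intro F hF
  have had := adapted_of_vee_eq_leftEnds hD
  refine mem_openComponent_iff.mpr ⟨hF.1, fun c => ?_, fun c => ?_⟩
  · obtain ⟨ht, hs⟩ := exists_sp_succ_eq_sup hF (i := S.top c) ⟨c, rfl⟩
    rw [hs]
    refine sup_le_sup_left ?_ _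
    rw [Submodule.span_singleton_le_iff_mem]
    have h1 := S.tN_top c
    exact ⟨pq n k (Sum.inl ⟨n - k - 1, by omega⟩), N_pow_pq_inl (by simp only; omega)⟩
  · have h1 := sp_le_range_of_mem_cupVariety hD (had.attractingSet_subset hF).1
      (x := S.bot c + 1) (by omega)
    have h2 := S.bN_bot c
    rw [bN_succ_of_mem_vee ⟨c, rfl⟩, show k - (S.bN (S.bot c) + 1) = c by omega] at h1
    exact h1.trans le_sup_right

theorem orientedCupVariety_eq_cupVariety (hD : S.vee = D.leftEnds) :
    S.orientedCupVariety D = D.cupVariety k := by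
  refine Set.Subset.antisymm (fun F hF => hF.1) fun F hF => ⟨hF, fun a ha hlt => ?_⟩
  exact absurd (by rw [hD]; exact hlt) (notMem_vee_of_mem_wedge ha)

theorem IsStandard.component_eq (hS : S.IsStandard) (hnk : 2 * k ≤ n)
    (hD : S.vee = D.leftEnds) : S.component = D.cupVariety k := by
  refine Set.Subset.antisymm (closure_minimal (hS.openComponent_subset hnk hD)
    (isClosed_cupVariety S.card_le)) ?_
  rw [← orientedCupVariety_eq_cupVariety hD]
  exact (adapted_of_vee_eq_leftEnds hD).orientedCupVariety_subset_closure.trans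
    (closure_mono (attractingSet_subset_openComponent hD))

theorem IsStandard.stableManifold_eq (hS : S.IsStandard) (hnk : 2 * k ≤ n)
    (hD : S.vee = D.leftEnds) (hw : w.Adapted D) :
    w.stableManifold = {F | F ∈ S.component ∧
      ∀ i : Fin n, i ∈ w.wedge ∩ S.vee → F.space i.succ = w.fixedFlag.space i.succ} := by
  rw [hw.stableManifold_eq, hS.component_eq hnk hD, hD]
  ext F
  simp only [orientedCupVariety, Set.mem_ofPred_eq, ← CompleteFlag.sp_succ]
  exact and_congr_right fun _ => ⟨fun h i hi => h i hi.1 hi.2, fun h i h1 h2 => h i ⟨h1, h2⟩⟩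

end RowStrictTableau

/-! ### Existence and uniqueness of the cup diagrams -/

namespace CupDiagram

instance : Finite (CupDiagram n) :=
  Finite.of_injective CupDiagram.partner fun _ _ => CupDiagram.ext

/-- The cup diagram without cups. -/
def empty (n : ℕ) : CupDiagram n where
  partner := id
  involutive _ := rfl
  crossingless _ _ h1 h2 := absurd h2 (not_lt.mpr h1.le)

variable (C : CupDiagram n)

theorem between_of_fixed {i j y : Fin n} (hi : C.partner i = i) (hj : C.partner j = j)
    (hb : ∀ x, i < x → x < j → C.partner x ≠ x) (h1 : i < y) (h2 : y < j) :
    i < C.partner y ∧ C.partner y < j := by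
  have hne := hb y h1 h2
  constructor
  · by_contra hlt
    have h3 : C.partner y ≠ i := fun h => by
      rw [← h, C.partner_partner] at hi
      exact hne hi.symm
    exact (C.crossingless (C.partner y) i (lt_of_le_of_ne (not_lt.mp hlt) h3)
      (by rwa [C.partner_partner])).1 hi
  · by_contra hlt
    have h3 : j ≠ C.partner y := fun h => by
      rw [h, C.partner_partner] at hj
      exact hne hj.symm
    exact (C.crossingless y j h2 (lt_of_le_of_ne (not_lt.mp hlt) h3)).1 hj

/-- Join two neighbouring rays to a cup. -/
def addCup (i j : Fin n) (hi : C.partner i = i) (hj : C.partner j = j) (hij : i < j)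
    (hb : ∀ x, i < x → x < j → C.partner x ≠ x) : CupDiagram n where
  partner x := if x = i then j else if x = j then i else C.partner x
  involutive x := by
    by_cases h1 : x = i
    · subst h1; simp
    by_cases h2 : x = j
    · subst h2; simp
    have h3 : C.partner x ≠ i := fun h => h1 (C.involutive.injective (h.trans hi.symm))
    have h4 : C.partner x ≠ j := fun h => h2 (C.involutive.injective (h.trans hj.symm))
    simp [h1, h2, h3, h4, C.partner_partner]
  crossingless a y hay hya := by
    by_cases h1 : a = i
    · subst h1
      rw [if_pos rfl] at hya ⊢
      rw [if_neg hay.ne', if_neg hya.ne]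
      exact ⟨hb y hay hya, C.between_of_fixed hi hj hb hay hya⟩
    by_cases h2 : a = j
    · subst h2
      rw [if_neg hij.ne', if_pos rfl] at hya
      exact absurd (hay.trans hya) (not_lt.mpr hij.le)
    rw [if_neg h1, if_neg h2] at hya ⊢
    have h3 := C.crossingless a y hay hya
    have h4 : y ≠ i := by rintro rfl; exact h3.1 hi
    have h5 : y ≠ j := by rintro rfl; exact h3.1 hj
    rwa [if_neg h4, if_neg h5]

section addCup

variable {C} {i j : Fin n} (hi : C.partner i = i) (hj : C.partner j = j) (hij : i < j)
  (hb : ∀ x, i < x → x < j → C.partner x ≠ x)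

theorem addCup_partner_left : (C.addCup i j hi hj hij hb).partner i = j := if_pos rfl

theorem addCup_partner_of_ne {x : Fin n} (h : C.partner x ≠ x) :
    (C.addCup i j hi hj hij hb).partner x = C.partner x := by
  change (if x = i then j else if x = j then i else C.partner x) = _
  have h1 : x ≠ i := by rintro rfl; exact h hi
  have h2 : x ≠ j := by rintro rfl; exact h hj
  rw [if_neg h1, if_neg h2]

theorem leftEnds_addCup : (C.addCup i j hi hj hij hb).leftEnds = insert i C.leftEnds := by
  ext x
  change x < (if x = i then j else if x = j then i else C.partner x) ↔ x = i ∨ x < C.partner x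
  by_cases h1 : x = i
  · subst h1; simp [hij]
  by_cases h2 : x = j
  · subst h2; simp [h1, hj, hij.le]
  · simp [h1, h2]

theorem numCups_addCup : (C.addCup i j hi hj hij hb).numCups = C.numCups + 1 := by
  rw [numCups, leftEnds_addCup, Set.ncard_insert_of_notMem, numCups]
  exact fun h => (show i < C.partner i from h).ne hi.symm

end addCup

/-- Any ray strictly between `i` and `j` can replace one of them, according to whether it belongs to
`A`. -/
theorem exists_adjacent_fixed {A : Set (Fin n)} {i j : Fin n} (hiA : i ∈ A) (hjA : j ∉ A)
    (hi : C.partner i = i) (hj : C.partner j = j) (hij : i < j) :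
    ∃ i' j', i' ∈ A ∧ j' ∉ A ∧ C.partner i' = i' ∧ C.partner j' = j' ∧ i' < j' ∧
      ∀ x, i' < x → x < j' → C.partner x ≠ x := by
  induction hm : (j : ℕ) - i using Nat.strong_induction_on generalizing i j with
  | _ m ih =>
  subst hm
  by_cases h : ∀ x, i < x → x < j → C.partner x ≠ x
  · exact ⟨i, j, hiA, hjA, hi, hj, hij, h⟩
  push Not at h
  obtain ⟨x, h1, h2, hx⟩ := h
  have h1' : (i : ℕ) < x := h1
  have h2' : (x : ℕ) < j := h2
  by_cases hxA : x ∈ A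
  · exact ih _ (by omega) hxA hjA hx hj h2 rfl
  · exact ih _ (by omega) hiA hxA hi hx h1 rfl

end CupDiagram

namespace RowStrictTableau

variable {w : RowStrictTableau n k} {C D : CupDiagram n}

theorem ncard_vee : w.vee.ncard = k := by
  rw [vee, ← Set.image_univ, Set.ncard_image_of_injective _ w.bot_anti.injective, Set.ncard_univ]
  simp

theorem ncard_wedge : w.wedge.ncard = n - k := by
  rw [wedge, ← Set.image_univ, Set.ncard_image_of_injective _ w.top_anti.injective, Set.ncard_univ]
  simp

theorem exists_isCupDiagram (w : RowStrictTableau n k) : ∃ C, w.IsCupDiagram C := by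
  obtain ⟨C, h1, h2⟩ := Set.exists_max_image {C | w.OrientsCounterclockwise C} CupDiagram.numCups
    (Set.toFinite _) ⟨CupDiagram.empty n, fun i hi => absurd hi (lt_irrefl i)⟩
  exact ⟨C, h1, h2⟩

theorem OrientsCounterclockwise.orients (h : w.OrientsCounterclockwise C) : w.Orients C :=
  fun i hi => Or.inl (h i hi)

theorem OrientsCounterclockwise.partner_lt (h : w.OrientsCounterclockwise C) {i : Fin n}
    (hi : i ∈ w.wedge) (hne : C.partner i ≠ i) : C.partner i < i := by
  by_contra hlt
  exact notMem_vee_of_mem_wedge hi (h i (lt_of_le_of_ne (not_lt.mp hlt) hne.symm)).1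

theorem OrientsCounterclockwise.lt_partner (h : w.OrientsCounterclockwise C) {i : Fin n}
    (hi : i ∈ w.vee) (hne : C.partner i ≠ i) : i < C.partner i := by
  by_contra hlt
  have h1 : C.partner i < C.partner (C.partner i) := by
    rw [C.partner_partner]
    exact lt_of_le_of_ne (not_lt.mp hlt) hne
  have h2 := (h _ h1).2
  rw [C.partner_partner] at h2
  exact notMem_vee_of_mem_wedge h2 hi

/-- Otherwise two neighbouring rays marked ∨, ∧ could be joined to one more counter-clockwise cup,
against maximality. -/
theorem IsCupDiagram.lt_of_fixed (h : w.IsCupDiagram C) {i j : Fin n} (hi : i ∈ w.wedge)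
    (hj : j ∈ w.vee) (hi' : C.partner i = i) (hj' : C.partner j = j) : i < j := by
  by_contra hlt
  have hne : j ≠ i := fun h => notMem_vee_of_mem_wedge hi (h ▸ hj)
  obtain ⟨a, b, ha, hb, ha', hb', hab, hbet⟩ := C.exists_adjacent_fixed hj
    (notMem_vee_of_mem_wedge hi) hj' hi' (lt_of_le_of_ne (not_lt.mp hlt) hne)
  have h1 := h.2 (C.addCup a b ha' hb' hab hbet) fun x hx => ?_
  · rw [CupDiagram.numCups_addCup] at h1
    omega
  · rw [CupDiagram.leftEnds_addCup] at hx
    rcases hx with rfl | hx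
    · rw [CupDiagram.addCup_partner_left]
      exact ⟨ha, notMem_vee_iff.mp hb⟩
    · rw [CupDiagram.addCup_partner_of_ne _ _ _ _ (show x < C.partner x from hx).ne']
      exact h.1 x hx

theorem Orients.numCups_eq (h : w.Orients D) :
    D.numCups = {j | j ∈ w.vee ∧ D.partner j ≠ j}.ncard := by
  classical
  refine Set.ncard_congr (fun a _ => if a ∈ w.vee then a else D.partner a) ?_ ?_ ?_
  · intro a ha
    have ha' : a < D.partner a := ha
    split_ifs with h1
    · exact ⟨h1, ha'.ne'⟩
    · refine ⟨(h.partner_mem_vee_iff ha'.ne').mpr (notMem_vee_iff.mp h1), ?_⟩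
      rw [D.partner_partner]
      exact ha'.ne
  · intro a b ha hb hab
    have ha' : a < D.partner a := ha
    have hb' : b < D.partner b := hb
    split_ifs at hab with h1 h2 h2
    · exact hab
    · rw [hab, D.partner_partner] at ha'
      exact absurd ha' (not_lt.mpr hb'.le)
    · rw [← hab, D.partner_partner] at hb'
      exact absurd hb' (not_lt.mpr ha'.le)
    · exact D.involutive.injective hab
  · rintro j ⟨hj, hne⟩
    rcases lt_or_gt_of_ne hne with hlt | hlt
    · refine ⟨D.partner j, ?_, ?_⟩
      · change D.partner j < D.partner (D.partner j)
        rwa [D.partner_partner]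
      · rw [if_neg (notMem_vee_iff.mpr ((h.partner_mem_wedge_iff hne).mpr hj)), D.partner_partner]
    · exact ⟨j, hlt, if_pos hj⟩

theorem Orients.numCups_eq_wedge (h : w.Orients D) :
    D.numCups = {j | j ∈ w.wedge ∧ D.partner j ≠ j}.ncard := by
  rw [h.numCups_eq, ← Set.ncard_image_of_injective _ D.involutive.injective]
  congr 1
  ext j
  simp only [Set.mem_image, Set.mem_ofPred_eq]
  constructor
  · rintro ⟨i, ⟨h1, h2⟩, rfl⟩
    exact ⟨(h.partner_mem_wedge_iff h2).mpr h1, by rw [D.partner_partner]; exact h2.symm⟩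
  · rintro ⟨h1, h2⟩
    exact ⟨D.partner j, ⟨(h.partner_mem_vee_iff h2).mpr h1, by rw [D.partner_partner]; exact h2.symm⟩,
      D.partner_partner j⟩

/-- Each cup uses one ∧ and one ∨, and there are at least `k` of either mark since `2 * k ≤ n`. -/
theorem Orients.exists_fixed (h : w.Orients D) (hnk : 2 * k ≤ n) (hlt : D.numCups < k) :
    (∃ i ∈ w.wedge, D.partner i = i) ∧ ∃ j ∈ w.vee, D.partner j = j := by
  constructor
  · by_contra! hcon
    rw [h.numCups_eq_wedge, show {j | j ∈ w.wedge ∧ D.partner j ≠ j} = w.wedge from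
      Set.ext fun j => ⟨fun h => h.1, fun h => ⟨h, hcon j h⟩⟩, ncard_wedge] at hlt
    omega
  · by_contra! hcon
    rw [h.numCups_eq, show {j | j ∈ w.vee ∧ D.partner j ≠ j} = w.vee from
      Set.ext fun j => ⟨fun h => h.1, fun h => ⟨h, hcon j h⟩⟩, ncard_vee] at hlt
    omega

theorem partner_eq_of_extends (h : ∀ i ∈ C.leftEnds, D.partner i = C.partner i) {i : Fin n}
    (hi : C.partner i ≠ i) : D.partner i = C.partner i := by
  rcases lt_or_gt_of_ne hi with hlt | hlt
  · have h1 := h (C.partner i) (by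
      change C.partner i < C.partner (C.partner i); rwa [C.partner_partner])
    rw [C.partner_partner] at h1
    rw [← h1, D.partner_partner, h1]
  · exact h i hlt

theorem fixed_of_extends (h : ∀ i ∈ C.leftEnds, D.partner i = C.partner i) {i : Fin n}
    (hi : D.partner i = i) : C.partner i = i := by
  by_contra hne
  rw [partner_eq_of_extends h hne] at hi
  exact hne hi

/-- While fewer than `k` cups are present, rays of both marks remain, the ∧'s to the left of the
∨'s. Joining a neighbouring pair adds a clockwise cup. -/
theorem IsCupDiagram.exists_isCompletion (h : w.IsCupDiagram C) (hnk : 2 * k ≤ n) :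
    ∃ D, w.IsCompletion C D := by
  have key : ∀ m : ℕ, ∀ D : CupDiagram n, (∀ i ∈ C.leftEnds, D.partner i = C.partner i) →
      w.Orients D → D.numCups + m = k → ∃ D', w.IsCompletion C D' := by
    intro m
    induction m with
    | zero => exact fun D h1 h2 h3 => ⟨D, h1, h2, h3⟩
    | succ m ih =>
      intro D h1 h2 h3
      obtain ⟨⟨i, hi, hi'⟩, j, hj, hj'⟩ := h2.exists_fixed hnk (by omega)
      have hij := h.lt_of_fixed hi hj (fixed_of_extends h1 hi') (fixed_of_extends h1 hj')
      obtain ⟨a, b, ha, hb, ha', hb', hab, hbet⟩ := D.exists_adjacent_fixed hi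
        (notMem_wedge_iff.mpr hj) hi' hj' hij
      refine ih (D.addCup a b ha' hb' hab hbet) (fun x hx => ?_) (fun x hx => ?_) ?_
      · have hx' : x < C.partner x := hx
        rw [CupDiagram.addCup_partner_of_ne, h1 x hx]
        rw [h1 x hx]
        exact hx'.ne'
      · rw [CupDiagram.leftEnds_addCup] at hx
        rcases hx with rfl | hx
        · rw [CupDiagram.addCup_partner_left]
          exact Or.inr ⟨ha, notMem_wedge_iff.mp hb⟩
        · rw [CupDiagram.addCup_partner_of_ne _ _ _ _ (show x < D.partner x from hx).ne']
          exact h2 x hx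
      · rw [CupDiagram.numCups_addCup]
        omega
  have hle : C.numCups ≤ k := by
    rw [h.1.orients.numCups_eq]
    exact (Set.ncard_le_ncard (fun j hj => hj.1) (Set.toFinite _)).trans ncard_vee.le
  exact key (k - C.numCups) C (fun _ _ => rfl) h.1.orients (by omega)

theorem IsCupDiagram.partner_ne_of_leftEnd (h : w.IsCupDiagram C) (hD : w.IsCompletion C D)
    {a : Fin n} (ha : a ∈ w.vee) (hlt : a < D.partner a) : C.partner a ≠ a := by
  intro hfix
  have hb : D.partner a ∈ w.wedge := (hD.2.1.partner_mem_wedge_iff hlt.ne').mpr ha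
  have hb' : C.partner (D.partner a) = D.partner a := by
    by_contra hne
    have h1 := partner_eq_of_extends hD.1 hne
    rw [D.partner_partner] at h1
    have h2 := congrArg C.partner h1
    rw [C.partner_partner, hfix] at h2
    exact hlt.ne h2
  exact absurd (h.lt_of_fixed hb ha hb' hfix) (not_lt.mpr hlt.le)

theorem IsCompletion.partner_ne (hD : w.IsCompletion C D) {j : Fin n} (hj : j ∈ w.vee) :
    D.partner j ≠ j := by
  have h1 := hD.2.1.numCups_eq
  rw [hD.2.2] at h1
  have h2 : {j | j ∈ w.vee ∧ D.partner j ≠ j} = w.vee :=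
    Set.eq_of_subset_of_ncard_le (fun j hj => hj.1) (by rw [← h1, ncard_vee]) (Set.toFinite _)
  rw [← h2] at hj
  exact hj.2

theorem IsCupDiagram.fixed_of_mem_wedge (h : w.IsCupDiagram C) (hD : w.IsCompletion C D)
    {i : Fin n} (hi : i ∈ w.wedge) (hle : i ≤ D.partner i) : C.partner i = i := by
  by_contra hne
  have := h.1.partner_lt hi hne
  rw [← partner_eq_of_extends hD.1 hne] at this
  exact absurd this (not_lt.mpr hle)

theorem IsCupDiagram.fixed_of_mem_vee (h : w.IsCupDiagram C) (hD : w.IsCompletion C D)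
    {i : Fin n} (hi : i ∈ w.vee) (hle : D.partner i ≤ i) : C.partner i = i := by
  by_contra hne
  have := h.1.lt_partner hi hne
  rw [← partner_eq_of_extends hD.1 hne] at this
  exact absurd this (not_lt.mpr hle)

/-- A counter-clockwise cup of `D` already belongs to `C`, hence so do all cups below it. The ends
of the added cups are rays of `C`, whose order gives `sep`, and `k` cups use up every ∨. -/
theorem IsCupDiagram.adapted (h : w.IsCupDiagram C) (hD : w.IsCompletion C D) :
    w.Adapted D where
  orients := hD.2.1
  ray i hi := notMem_vee_iff.mp fun hv => hD.partner_ne hv hi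
  inner a i ha hai hia hi := by
    have h1 := h.partner_ne_of_leftEnd hD ha (hai.trans hia)
    rw [partner_eq_of_extends hD.1 h1] at hia
    have h2 := (C.crossingless a i hai hia).1
    rw [partner_eq_of_extends hD.1 h2] at hi
    exact (h.1 i hi).1
  sep i j hi hi' hj hj' := h.lt_of_fixed hi hj (h.fixed_of_mem_wedge hD hi hi')
    (h.fixed_of_mem_vee hD hj hj')

/-- Before the cup at `a` closes, each ∧ is matched with a ∨ strictly after `a`, while `a` itself is
left over. This locates the partner of `a` by the marks alone and yields uniqueness. -/
theorem IsCupDiagram.ncard_wedge_lt (h : w.IsCupDiagram C) {a : Fin n} (ha : a ∈ w.vee) {y : ℕ}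
    (hay : a < y) (hy : C.partner a ≠ a → y ≤ C.partner a) :
    {j : Fin n | (a : ℕ) ≤ j ∧ (j : ℕ) < y ∧ j ∈ w.wedge}.ncard
      < {j : Fin n | (a : ℕ) ≤ j ∧ (j : ℕ) < y ∧ j ∈ w.vee}.ncard := by
  rw [← Set.ncard_image_of_injective _ C.involutive.injective]
  refine Set.ncard_lt_ncard ?_ (Set.toFinite _)
  have key : ∀ j : Fin n, (a : ℕ) ≤ j → (j : ℕ) < y → j ∈ w.wedge →
      C.partner j ∈ w.vee ∧ a < C.partner j ∧ C.partner j < j := by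
    intro j h1 h2 hj
    have haj : a < j := lt_of_le_of_ne h1 fun h => notMem_vee_of_mem_wedge hj (h ▸ ha)
    have hne : C.partner j ≠ j := by
      by_cases hfix : C.partner a = a
      · exact fun hj' => absurd (h.lt_of_fixed hj ha hj' hfix) (not_lt.mpr haj.le)
      · exact (C.crossingless a j haj (Fin.lt_def.mpr (by have := hy hfix; omega))).1
    have hlt := h.1.partner_lt hj hne
    refine ⟨(h.1.orients.partner_mem_vee_iff hne).mpr hj, ?_, hlt⟩
    by_cases hfix : C.partner a = a
    · by_contra hle
      have h3 : C.partner j ≠ a := fun h3 => by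
        rw [← h3, C.partner_partner] at hfix
        exact hne hfix.symm
      exact (C.crossingless (C.partner j) a (lt_of_le_of_ne (not_lt.mp hle) h3)
        (by rwa [C.partner_partner])).1 hfix
    · exact (C.crossingless a j haj (Fin.lt_def.mpr (by have := hy hfix; omega))).2.1
  refine (Set.ssubset_iff_of_subset ?_).mpr ⟨a, ⟨le_rfl, hay, ha⟩, ?_⟩
  · rintro _ ⟨j, ⟨h1, h2, h3⟩, rfl⟩
    obtain ⟨h4, h5, h6⟩ := key j h1 h2 h3
    have h5' : (a : ℕ) < C.partner j := h5
    have h6' : (C.partner j : ℕ) < j := h6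
    exact ⟨h5'.le, h6'.trans h2, h4⟩
  · rintro ⟨j, ⟨h1, h2, h3⟩, hja⟩
    exact (key j h1 h2 h3).2.1.ne hja.symm

theorem IsCupDiagram.partner_eq {C' : CupDiagram n} (h : w.IsCupDiagram C)
    (h' : w.IsCupDiagram C') {a : Fin n} (ha : a ∈ w.vee) (hne : C.partner a ≠ a) :
    C'.partner a = C.partner a := by
  have key : ∀ {C C' : CupDiagram n}, w.IsCupDiagram C → w.IsCupDiagram C' → C.partner a ≠ a →
      ¬ (C'.partner a ≠ a → C.partner a < C'.partner a) := by
    intro C C' h h' hne hcon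
    have hlt := h.1.lt_partner ha hne
    have h1 := h.1.orients.ncard_cup hlt
    have hlt' : (a : ℕ) < C.partner a := hlt
    exact (h'.ncard_wedge_lt ha (y := C.partner a + 1) (by omega) hcon).ne h1
  have h1 := key h h' hne
  push Not at h1
  have h2 := key h' h h1.1
  push Not at h2
  exact le_antisymm h1.2 h2.2

theorem IsCupDiagram.unique {C' : CupDiagram n} (h : w.IsCupDiagram C)
    (h' : w.IsCupDiagram C') : C = C' := by
  have key : ∀ {C C' : CupDiagram n}, w.IsCupDiagram C → w.IsCupDiagram C' → ∀ i,
      C.partner i ≠ i → C'.partner i = C.partner i := by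
    intro C C' h h' i hne
    rcases w.mem_wedge_or_mem_vee i with hi | hi
    · have h1 := h.partner_eq h' ((h.1.orients.partner_mem_vee_iff hne).mpr hi)
        (by rw [C.partner_partner]; exact hne.symm)
      rw [C.partner_partner] at h1
      rw [← h1, C'.partner_partner, h1]
    · exact h.partner_eq h' hi hne
  ext1
  funext i
  by_cases h1 : C.partner i = i
  · by_cases h2 : C'.partner i = i
    · rw [h1, h2]
    · exact key h' h i h2
  · exact (key h h' i h1).symm

/-- The partner of `i` in `D` is a ∨-ray of `C`, hence lies right of `j`. So `j` is below a cup of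
`D` and is matched there too, again with a ∨-ray of `C` to its right. -/
theorem IsCupDiagram.mem_leftEnds_of_lt (h : w.IsCupDiagram C) (hD : w.IsCompletion C D)
    {i j : Fin n} (hi : i ∈ w.wedge) (hi' : i ∈ D.leftEnds) (hij : i < j) (hj : j ∈ w.wedge)
    (hj' : C.partner j = j) : j ∈ D.leftEnds := by
  have hlt : i < D.partner i := hi'
  have hv : D.partner i ∈ w.vee := (hD.2.1.partner_mem_vee_iff hlt.ne').mpr hi
  have hvf := h.fixed_of_mem_vee hD hv (by rw [D.partner_partner]; exact hlt.le)
  have hne := (D.crossingless i j hij (h.lt_of_fixed hj hv hj' hvf)).1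
  change j < D.partner j
  by_contra hle
  have hv' : D.partner j ∈ w.vee := (hD.2.1.partner_mem_vee_iff hne).mpr hj
  have hvf' : C.partner (D.partner j) = D.partner j := by
    by_contra hcon
    have h1 := partner_eq_of_extends hD.1 hcon
    rw [D.partner_partner] at h1
    have h2 := congrArg C.partner h1
    rw [C.partner_partner, hj'] at h2
    exact hne h2.symm
  exact hle (h.lt_of_fixed hj hv' hj' hvf')

/-- Two completions can differ in left ends only at ∧-rays of `C`, and the chosen ones are closed to
the right. The two sets are therefore nested, and they have the same size. -/
theorem IsCupDiagram.leftEnds_subset {D' : CupDiagram n} (h : w.IsCupDiagram C)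
    (hD : w.IsCompletion C D) (hD' : w.IsCompletion C D') : D.leftEnds ⊆ D'.leftEnds := by
  have key : ∀ {D D' : CupDiagram n}, w.IsCompletion C D → w.IsCompletion C D' → ∀ x,
      x ∈ D.leftEnds → x ∉ D'.leftEnds → x ∈ w.wedge ∧ C.partner x = x := by
    intro D D' hD hD' x hx hx'
    have hfix : C.partner x = x := by
      by_contra hne
      apply hx'
      change x < D'.partner x
      rw [partner_eq_of_extends hD'.1 hne, ← partner_eq_of_extends hD.1 hne]
      exact hx
    exact ⟨notMem_vee_iff.mp fun hv => h.partner_ne_of_leftEnd hD hv hx hfix, hfix⟩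
  intro x hx
  by_contra hx'
  obtain ⟨hxw, hxf⟩ := key hD hD' x hx hx'
  have hsub : D'.leftEnds ⊂ D.leftEnds := by
    refine (Set.ssubset_iff_of_subset fun y hy => ?_).mpr ⟨x, hx, hx'⟩
    by_contra hy'
    obtain ⟨hyw, hyf⟩ := key hD' hD y hy hy'
    rcases lt_trichotomy x y with hxy | rfl | hxy
    · exact hy' (h.mem_leftEnds_of_lt hD hxw hx hxy hyw hyf)
    · exact hx' hy
    · exact hx' (h.mem_leftEnds_of_lt hD' hyw hy hxy hxw hxf)
  have := Set.ncard_lt_ncard hsub (Set.toFinite _)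
  have h1 := hD.2.2
  have h2 := hD'.2.2
  rw [CupDiagram.numCups] at h1 h2
  omega

/-! ### Standard tableaux -/

theorem eq_of_vee_eq {S S' : RowStrictTableau n k} (h : S.vee = S'.vee) : S = S' := by
  have h' : S.wedge = S'.wedge := by
    ext i
    rw [← notMem_vee_iff, ← notMem_vee_iff, h]
  exact RowStrictTableau.ext ((S.top_anti.range_inj S'.top_anti).mp h')
    ((S.bot_anti.range_inj S'.bot_anti).mp h)

theorem exists_vee_eq (hk : k ≤ n) (A : Set (Fin n)) (hA : A.ncard = k) :
    ∃ S : RowStrictTableau n k, S.vee = A := by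
  classical
  have hA1 : A.toFinset.card = k := by rw [← Set.ncard_eq_toFinset_card', hA]
  have hA2 : (A.toFinset)ᶜ.card = n - k := by rw [Finset.card_compl, hA1, Fintype.card_fin]
  let f := A.toFinset.orderEmbOfFin hA1
  let g := (A.toFinset)ᶜ.orderEmbOfFin hA2
  have hf : Set.range f = A := by rw [Finset.range_orderEmbOfFin, Set.coe_toFinset]
  have hg : ∀ c, g c ∉ A := fun c hc =>
    Finset.mem_compl.mp (Finset.orderEmbOfFin_mem _ hA2 c) (Set.mem_toFinset.mpr hc)
  refine ⟨⟨fun c => g c.rev, fun c => f c.rev, fun a b hab => g.strictMono (Fin.rev_lt_rev.mpr hab),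
    fun a b hab => f.strictMono (Fin.rev_lt_rev.mpr hab), ?_⟩, ?_⟩
  · rw [Fintype.bijective_iff_injective_and_card]
    refine ⟨?_, by simp [hk]⟩
    refine Function.Injective.sumElim (g.injective.comp Fin.rev_injective)
      (f.injective.comp Fin.rev_injective) fun a b hab => ?_
    change g a.rev = f b.rev at hab
    exact hg a.rev (by rw [hab, ← hf]; exact ⟨_, rfl⟩)
  · change Set.range (f ∘ Fin.rev) = A
    rw [Fin.rev_surjective.range_comp, hf]

/-- Matching sends the ∨'s after a given point to ∧'s after it, so no final stretch has more ∨'s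
than ∧'s. -/
theorem isStandard_of_vee_eq {S : RowStrictTableau n k} (h : S.vee = D.leftEnds) :
    S.IsStandard := by
  intro a b hab
  by_contra hle
  have had := adapted_of_vee_eq_leftEnds h
  have hne : S.top a ≠ S.bot b := fun he =>
    notMem_vee_of_mem_wedge ⟨a, rfl⟩ ⟨b, he.symm⟩
  have hlt : (S.top a : ℕ) < S.bot b := Fin.lt_def.mp (lt_of_le_of_ne (not_lt.mp hle) hne)
  have h1 := countBelow_add (A := S.wedge) (x := S.top a + 1) (y := n) (by omega)
  have h2 := countBelow_add (A := S.vee) (x := S.top a + 1) (y := n) (by omega)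
  have h3 : {j : Fin n | (S.top a : ℕ) + 1 ≤ j ∧ (j : ℕ) < n ∧ j ∈ S.vee}.ncard
      ≤ {j : Fin n | (S.top a : ℕ) + 1 ≤ j ∧ (j : ℕ) < n ∧ j ∈ S.wedge}.ncard := by
    rw [← Set.ncard_image_of_injective _ D.involutive.injective]
    refine Set.ncard_le_ncard ?_ (Set.toFinite _)
    rintro _ ⟨j, ⟨h4, h5, h6⟩, rfl⟩
    have h7 : j < D.partner j := by rw [h] at h6; exact h6
    have h8 : (j : ℕ) < D.partner j := h7
    exact ⟨by omega, by omega, (had.orients.partner_mem_wedge_iff h7.ne').mpr h6⟩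
  have h4 := S.tN_top a
  have h5 := S.bN_bot b
  have h6 := S.tN_succ_of_mem_wedge (j := S.top a) ⟨a, rfl⟩
  have h7 : S.bN (S.top a + 1) ≤ S.bN (S.bot b) := countBelow_mono _ hlt
  have h8 := S.tN_last
  have h9 := S.bN_last
  unfold tN bN at *
  omega

/-- If a clockwise cup ended at `b`, every ∧ after `b` would close a counter-clockwise cup opened
after `b`. With `b` itself unmatched there, the stretch from `b` on would have more ∨'s than ∧'s. -/
theorem IsStandard.leftEnds_eq (hS : w.IsStandard) (hnk : 2 * k ≤ n) (h : w.IsCupDiagram C)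
    (hD : w.IsCompletion C D) : w.vee = D.leftEnds := by
  have had := h.adapted hD
  symm
  refine Set.eq_of_subset_of_ncard_le (fun a ha => ?_)
    (by rw [ncard_vee]; exact hD.2.2.ge) (Set.toFinite _)
  have hlt : a < D.partner a := ha
  by_contra hav
  have haw := notMem_vee_iff.mp hav
  set b := D.partner a with hb
  have hba : D.partner b = a := D.partner_partner a
  have hbv : b ∈ w.vee := (had.orients.partner_mem_vee_iff hlt.ne').mpr haw
  have h1 := countBelow_add (A := w.wedge) (x := b) (y := n) (by omega)
  have h2 := countBelow_add (A := w.vee) (x := b) (y := n) (by omega)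
  have key : ∀ j : Fin n, (b : ℕ) ≤ j → j ∈ w.wedge → D.partner j ∈ w.vee ∧ b < D.partner j := by
    intro j hj hjw
    have hjlt : D.partner j < j := by
      by_contra hle
      have := had.sep j b hjw (not_lt.mp hle) hbv (by rw [hba]; exact hlt.le)
      exact absurd this (not_lt.mpr hj)
    have hv := (had.orients.partner_mem_vee_iff hjlt.ne).mpr hjw
    refine ⟨hv, ?_⟩
    by_contra hle
    have h3 : D.partner j < b := by
      refine lt_of_le_of_ne (not_lt.mp hle) fun h3 => ?_
      rw [← D.partner_partner j, h3, hba] at hj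
      have : (a : ℕ) < b := hlt
      omega
    have h4 : b < j := lt_of_le_of_ne hj fun h4 => notMem_vee_of_mem_wedge hjw (h4 ▸ hbv)
    have h5 := D.crossingless (D.partner j) b h3 (by rwa [D.partner_partner])
    rw [hba] at h5
    exact hav (had.inner (D.partner j) a hv h5.2.1 h5.2.2 hlt)
  have h3 : {j : Fin n | (b : ℕ) ≤ j ∧ (j : ℕ) < n ∧ j ∈ w.wedge}.ncard
      < {j : Fin n | (b : ℕ) ≤ j ∧ (j : ℕ) < n ∧ j ∈ w.vee}.ncard := by
    rw [← Set.ncard_image_of_injective _ D.involutive.injective]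
    refine Set.ncard_lt_ncard ?_ (Set.toFinite _)
    refine (Set.ssubset_iff_of_subset ?_).mpr ⟨b, ⟨le_rfl, b.isLt, hbv⟩, ?_⟩
    · rintro _ ⟨j, ⟨h3, -, h4⟩, rfl⟩
      obtain ⟨h5, h6⟩ := key j h3 h4
      exact ⟨h6.le, (D.partner j).isLt, h5⟩
    · rintro ⟨j, ⟨h3, -, h4⟩, hjb⟩
      exact (key j h3 h4).2.ne hjb.symm
  -- Exactly c + 1 bottom entries are at least `b`; the top entry above `b` in its column exceeds
  -- `b`, so at least c + 1 top entries do too.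
  obtain ⟨c, hc⟩ := hbv
  have h4 := w.bN_bot c
  rw [hc] at h4
  have h5 := hS ⟨c, by omega⟩ c rfl
  rw [hc] at h5
  have h6 := w.tN_top ⟨c, by omega⟩
  have h7 : w.tN b ≤ w.tN (w.top ⟨c, by omega⟩) := countBelow_mono _ h5.le
  have h8 := w.tN_last
  have h9 := w.bN_last
  simp only at h6
  unfold tN bN at *
  omega

theorem existsUnique_isStandardTableauOf (hnk : 2 * k ≤ n) (w : RowStrictTableau n k) :
    ∃! S : RowStrictTableau n k, w.IsStandardTableauOf S := by
  obtain ⟨C, hC⟩ := w.exists_isCupDiagram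
  obtain ⟨D, hD⟩ := hC.exists_isCompletion hnk
  obtain ⟨S, hS⟩ := exists_vee_eq w.card_le D.leftEnds hD.2.2
  refine ⟨S, ⟨isStandard_of_vee_eq hS, C, D, hC, hD, hS⟩, ?_⟩
  rintro S' ⟨-, C', D', hC', hD', hS'⟩
  obtain rfl := hC.unique hC'
  refine eq_of_vee_eq ?_
  rw [hS, hS']
  exact Set.Subset.antisymm (hC.leftEnds_subset hD' hD) (hC.leftEnds_subset hD hD')

end RowStrictTableau

end

end TwoRowSpringer


theorem mainTheorem7 (n k : ℕ) (hnk : 2 * k ≤ n) :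
    (∀ w : TwoRowSpringer.RowStrictTableau n k,
      (∃! S : TwoRowSpringer.RowStrictTableau n k, w.IsStandardTableauOf S) ∧
      ∀ S : TwoRowSpringer.RowStrictTableau n k, w.IsStandardTableauOf S →
        w.stableManifold =
          {F | F ∈ S.component ∧
            ∀ i : Fin n, i ∈ w.wedge ∩ S.vee → F.space i.succ = w.fixedFlag.space i.succ}) ∧
    (∀ S : TwoRowSpringer.RowStrictTableau n k, S.IsStandard →
      S.stableManifold = S.component) := by
  refine ⟨fun w => ⟨w.existsUnique_isStandardTableauOf hnk, ?_⟩, fun S hS => ?_⟩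
  · rintro S ⟨hS, C, D, hC, hD, hv⟩
    exact hS.stableManifold_eq hnk hv (hC.adapted hD)
  · obtain ⟨C, hC⟩ := S.exists_isCupDiagram
    obtain ⟨D, hD⟩ := hC.exists_isCompletion hnk
    have hv := hS.leftEnds_eq hnk hC hD
    rw [hS.component_eq hnk hv, (hC.adapted hD).stableManifold_eq,
      TwoRowSpringer.RowStrictTableau.orientedCupVariety_eq_cupVariety hv]
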